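/- Let $F$ be a smooth manifold (without boundary) with a contact form $\alpha_F$, and let $B^2\subset\mathbb{C}$ be the open unit disk with polar coordinates $(r,\theta)$. A contact structure $\eta$ on $F\times B^2$ is called a *radial contact fibration* with contact fiber $(F,\alpha_F)$ if $\eta=\ker(\alpha_F+H\,d\theta)$ for a smooth function $H:F\times B^2\to\mathbb{R}$ with $H=O(r^2)$ at $r=0$ and $\partial H/\partial r>0$ for $r>0$ (over $r=0$ the form $H\,d\theta$ is extended by $0$). A property holds *near the boundary* of $F\times B^2$ if it holds on $U\cap(F\times B^2)$ for some open $U\supset F\times\partial B^2$ in $F\times\mathbb{C}$. Let $V$ be a smooth manifold with contact structures $\xi_0,\xi_1$, and let $f_t:V\to F\times B^2$, $t\in[0,1]$, be a smooth isotopy of diffeomorphisms such that $f_0$ is a contactomorphism from $(V,\xi_0)$ to $(F\times B^2,\eta_0)$ and $f_1$ is a contactomorphism from $(V,\xi_1)$ to $(F\times B^2,\eta_1)$, where $\eta_0$ and $\eta_1$ are radial contact fibrations with the same contact fiber $(F,\alpha_F)$. Assume that $f_1\circ f_0^{-1}$ is the identity near the boundary of $F\times B^2$, and that $\xi_0$ and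 $\xi_1$ agree on the corresponding part of $V$, that is, $\xi_0=\xi_1$ at $f_0^{-1}(x)$ for all $x$ near the boundary. (1) Then $\xi_0$ and $\xi_1$ are isotopic: there is a smooth isotopy $\Phi_t$, $t\in[0,1]$, of diffeomorphisms of $V$ with $\Phi_0=\mathrm{id}$ and $(\Phi_1)_*\xi_0=\xi_1$. It can be chosen so that $\Phi_1\circ f_0^{-1}=f_0^{-1}$ near the boundary, and, if $f_t\circ f_0^{-1}=\mathrm{id}$ near the boundary for all $t$ simultaneously, so that $\Phi_t\circ f_0^{-1}=f_0^{-1}$ near the boundary for all $t$ simultaneously. (2) Suppose moreover that $F$ is identified by a diffeomorphism with the unit sphere $S^{2n-1}\subset\mathbb{C}^n$, $n\ge 1$, let $a\ge 1$, let $\mathbb{Z}_a$ act diagonally on $F\times B^2$ by $k\cdot(w,z)=(e^{2\pi i k/a}w,\,e^{2\pi i k/a}z)$, and assume that this action preserves $\eta_0$ and $\eta_1$. Then $\eta_0$ and $\eta_1$ are isotopic through $\mathbb{Z}_a$-equivariant diffeomorphisms: there is a smooth isotopy $\Psi_t$ of $F\times B^2$ with $\Psi_0=\mathrm{id}$ and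 $(\Psi_1)_*\eta_0=\eta_1$, such that every $\Psi_t$ commutes with the action and all $\Psi_t$ are simultaneously the identity near the boundary. Furthermore, for every action of $\mathbb{Z}_a$ on $V$ for which all the $f_t$ are equivariant, the isotopy $\Phi_t$ between $\xi_0$ and $\xi_1$ in (1), with the boundary properties stated there, can be chosen so that every $\Phi_t$ is $\mathbb{Z}_a$-equivariant. -/

import Mathlib

open Set Filter Topology
open scoped Manifold ContDiff

noncomputable section

namespace RadialContact

section General

variable {E : Type*} [NormedAddCommGroup E] [NormedSpace ℝ E]
  {H : Type*} [TopologicalSpace H] (I : ModelWithCorners ℝ E H)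
  {E' : Type*} [NormedAddCommGroup E'] [NormedSpace ℝ E']
  {H' : Type*} [TopologicalSpace H'] (I' : ModelWithCorners ℝ E' H')

/-- A (set-theoretic) differential 1-form on a manifold; smoothness is a separate condition. -/
abbrev OneForm (M : Type*) [TopologicalSpace M] [ChartedSpace H M] : Type _ :=
  (x : M) → (TangentSpace I x →L[ℝ] ℝ)

/-- A field of tangent subspaces. -/
abbrev Distribution (M : Type*) [TopologicalSpace M] [ChartedSpace H M] : Type _ :=
  (x : M) → Submodule ℝ (TangentSpace I x)

variable {I I'}
variable {M : Type*} [TopologicalSpace M] [ChartedSpace H M]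
  {N : Type*} [TopologicalSpace N] [ChartedSpace H' N]

/-- The 1-form `β` in the coordinates of the chart around `x₀`, that is, its pullback under the
inverse of this chart (all manifolds considered here have no boundary). -/
def OneForm.inChart (β : OneForm I M) (x₀ : M) : E → (E →L[ℝ] ℝ) :=
  fun y =>
    let γ : TangentSpace 𝓘(ℝ, E) y →L[ℝ] ℝ :=
      (β ((extChartAt I x₀).symm y)).comp (mfderiv 𝓘(ℝ, E) I (extChartAt I x₀).symm y)
    γ

/-- `β` is a smooth 1-form on the open set `U`. -/
def OneForm.SmoothOn (β : OneForm I M) (U : Set M) : Prop :=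
  ∀ x₀ : M, ContDiffOn ℝ ∞ (β.inChart x₀)
    ((extChartAt I x₀).target ∩ (extChartAt I x₀).symm ⁻¹' U)

/-- The value at `x` of the exterior derivative, `dβ(u, v) = ∂ᵤ(β(v)) - ∂ᵥ(β(u))`, computed in the
chart around `x`; the tangent space at `x` is identified with the model space by this very chart,
as in the definition of `TangentSpace`. -/
def OneForm.d (β : OneForm I M) (x : M) (u v : TangentSpace I x) : ℝ :=
  let D : E →L[ℝ] E →L[ℝ] ℝ := fderiv ℝ (β.inChart x) (extChartAt I x x)
  let u' : E := u
  let v' : E := v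
  D u' v' - D v' u'

/-- `β` is a contact form on the open set `U`: it is smooth and nowhere zero there, and `dβ` is
nondegenerate on `ker β` (equivalently `β ∧ (dβ)ⁿ ≠ 0`). -/
structure OneForm.IsContactOn (β : OneForm I M) (U : Set M) : Prop where
  smoothOn : β.SmoothOn U
  ne_zero : ∀ x ∈ U, β x ≠ 0
  nondegenerate : ∀ x ∈ U, ∀ u : TangentSpace I x, β x u = 0 →
    (∀ v : TangentSpace I x, β x v = 0 → β.d x u v = 0) → u = 0

/-- A contact structure: a field of tangent hyperplanes which is, locally, the kernel of a contact
form. -/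
def IsContactStructure (ξ : Distribution I M) : Prop :=
  ∀ x : M, ∃ U : Set M, IsOpen U ∧ x ∈ U ∧ ∃ β : OneForm I M, β.IsContactOn U ∧
    ∀ y ∈ U, ∀ v : TangentSpace I y, v ∈ ξ y ↔ β y v = 0

/-- The map `φ` carries the distribution `ξ` to the distribution `η`:
`dφ (ξ x) = η (φ x)` at every point `x`. -/
def Carries (φ : M → N) (ξ : Distribution I M) (η : Distribution I' N) : Prop :=
  ∀ x : M, (ξ x).map (mfderiv I I' φ x).toLinearMap = η (φ x)

/-- A smooth isotopy of diffeomorphisms, parametrized by the time interval `[0, 1]` (the values at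
other times are irrelevant): a family of diffeomorphisms depending smoothly on time and point
together. -/
def IsSmoothIsotopy (f : ℝ → M ≃ₘ⟮I, I'⟯ N) : Prop :=
  ContMDiffOn (𝓘(ℝ, ℝ).prod I) I' ∞ (fun q : ℝ × M => f q.1 q.2) (Icc (0 : ℝ) 1 ×ˢ univ)

/-- `Φ` is a smooth isotopy of `M` which starts at the identity and whose time-one map carries `ξ`
to `ξ'`, that is, `Φ` is an isotopy between `ξ` and `ξ'`. -/
structure IsIsotopyBetween (Φ : ℝ → M ≃ₘ⟮I, I⟯ M) (ξ ξ' : Distribution I M) : Prop where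
  smooth : IsSmoothIsotopy Φ
  zero : ∀ x, Φ 0 x = x
  one : Carries (Φ 1) ξ ξ'

end General

/-- The open unit disk. -/
def disk : TopologicalSpace.Opens ℂ := ⟨Metric.ball 0 1, Metric.isOpen_ball⟩

/-- The 1-form `dθ = (x dy - y dx) / (x² + y²)` on the plane minus the origin (set to be `0` at the
origin). -/
def dTheta (z : ℂ) : ℂ →L[ℝ] ℝ :=
  (Complex.normSq z)⁻¹ • (z.re • Complex.imCLM - z.im • Complex.reCLM)

section Fibration

variable {E : Type*} [NormedAddCommGroup E] [NormedSpace ℝ E]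
  {H : Type*} [TopologicalSpace H] {I : ModelWithCorners ℝ E H}
  {F : Type*} [TopologicalSpace F] [ChartedSpace H F]

/-- The 1-form `α + h dθ` on `F × B²`. At the points over the origin of the disk it is `α`, which is
the continuous extension when `h = O(r²)`. -/
def radialForm (α : OneForm I F) (h : F × ℂ → ℝ) : OneForm (I.prod 𝓘(ℝ, ℂ)) (F × disk) :=
  fun x =>
    (α x.1).comp (mfderiv (I.prod 𝓘(ℝ, ℂ)) I (fun y : F × disk => y.1) x) +
    h (x.1, (x.2 : ℂ)) •
      (dTheta (x.2 : ℂ)).comp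
        (mfderiv (I.prod 𝓘(ℝ, ℂ)) 𝓘(ℝ, ℂ) (fun y : F × disk => (y.2 : ℂ)) x)

/-- The distribution `η` on `F × B²` makes the projection to the disk a radial contact fibration
with contact form `α` on the fiber: `η` is a contact structure, and `η = ker (α + h dθ)` with a
smooth function `h : F × B² → ℝ` (its values outside the open disk are irrelevant) such that
`h = O(r²)` at the origin and `∂h/∂r > 0` for `r > 0`. -/
structure IsRadialContactFibration (α : OneForm I F)
    (η : Distribution (I.prod 𝓘(ℝ, ℂ)) (F × disk)) : Prop where
  contact : IsContactStructure η
  radial : ∃ h : F × ℂ → ℝ,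
    ContMDiffOn (I.prod 𝓘(ℝ, ℂ)) 𝓘(ℝ, ℝ) ∞ h (univ ×ˢ Metric.ball (0 : ℂ) 1) ∧
    (∀ p : F, (fun z : ℂ => h (p, z)) =O[𝓝 0] fun z : ℂ => ‖z‖ ^ 2) ∧
    (∀ (p : F) (θ r : ℝ), 0 < r → r < 1 →
      0 < deriv (fun s : ℝ => h (p, (s : ℂ) * Complex.exp (θ * Complex.I))) r) ∧
    ∀ (x : F × disk) (v : TangentSpace (I.prod 𝓘(ℝ, ℂ)) x),
      v ∈ η x ↔ radialForm α h x v = 0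

variable (F) in
/-- The filter of neighbourhoods of the boundary `F × ∂B²` in `F × B²`: a property holds eventually
along this filter if it holds on the trace on `F × B²` of some neighbourhood of `F × S¹` in
`F × ℂ`. -/
def nearBoundary : Filter (F × disk) :=
  comap (fun x => (x.1, (x.2 : ℂ))) (𝓝ˢ (univ ×ˢ Metric.sphere (0 : ℂ) 1 : Set (F × ℂ)))

end Fibration

/-- The unit sphere of `ℂⁿ⁺¹`, of dimension `2n + 1`. -/
abbrev oddSphere (n : ℕ) : Type := Metric.sphere (0 : EuclideanSpace ℂ (Fin (n + 1))) 1

instance finrank_fact (n : ℕ) :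
    Fact (Module.finrank ℝ (EuclideanSpace ℂ (Fin (n + 1))) = (2 * n + 1) + 1) :=
  ⟨by
    rw [← Module.finrank_mul_finrank ℝ ℂ (EuclideanSpace ℂ (Fin (n + 1)))]
    simp [Complex.finrank_real_complex]
    ring⟩

/-- Multiplication by the unit complex number `ζ` on the odd sphere (rotation along the Hopf
fibers). -/
def rotSphere {n : ℕ} (ζ : Circle) (w : oddSphere n) : oddSphere n :=
  ⟨(ζ : ℂ) • (w : EuclideanSpace ℂ (Fin (n + 1))), by simp [norm_smul, Circle.norm_coe]⟩

/-- Rotation of the disk by the unit complex number `ζ`. -/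
def rotDisk (ζ : Circle) (z : disk) : disk :=
  ⟨(ζ : ℂ) * (z : ℂ), by
    have h : ‖(z : ℂ)‖ < 1 := mem_ball_zero_iff.1 z.2
    exact mem_ball_zero_iff.2 (by rwa [norm_mul, Circle.norm_coe, one_mul])⟩

/-- The diagonal action of `ℤ/a` on `F × B²`, where `F` is identified with the odd sphere by `σ`:
the class of `k` rotates both the sphere and the disk by `exp(2πik/a)`. -/
def diagonalAction {F : Type*} {n : ℕ} (σ : F ≃ oddSphere n) {a : ℕ} [NeZero a] (k : ZMod a)
    (x : F × disk) : F × disk :=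
  (σ.symm (rotSphere (ZMod.toCircle k) (σ x.1)), rotDisk (ZMod.toCircle k) x.2)

end RadialContact

end

noncomputable section

namespace RadialContact

/-! No Gray stability or vector field flow is needed; the isotopy is written down explicitly. First,
`h = r² g` with `g` smooth and positive up to the origin, so that `η = ker (α + g (x dy - y dx))`.
Smoothness of `h` and its order of vanishing would not suffice for this (`x²/r²` is not continuous).
The smooth contact form defining `η` locally makes `g` smooth, by Hadamard's lemma, and its
nondegeneracy gives `g ≠ 0` over the origin. This is `exists_contDiff_weight`, used in
`IsRadialContactFibration.exists_profile`.

The fibrewise radial map `S_g z = √g z` pulls `x dy - y dx` back to `g (x dy - y dx)`. Monotonicity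
of `r² g` along rays makes it an injective local diffeomorphism. Both conditions on `g` are convex,
so `g₀` and `g₁` are joined by linear interpolations `g_t`. Agreement of the distributions near the
boundary gives `g₀ = g₁` there, and the intermediate value theorem on rays then gives all `S_{g_t}`
the same image over each point of `F`. Hence `Ψ_t = S_{g_t}⁻¹ ∘ S_{g₀}` is defined, carries `η₀` to
`η₁` at time one, and fixes every point where `g₀ = g₁` (`IsProfile.exists_isotopy`,
`carries_of_spread_eq`).

A fibered symmetry covering a rotation of the disk need only preserve the kernels, not `α`. It
multiplies `g₀` and `g₁` by the same function on `F` (`exists_rescale_of_carries`), hence every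
`g_t` as well, and uniqueness in the definition of `Ψ_t` makes it commute with the symmetry
(`exists_model_isotopy`). On `V` one takes `Φ_t = f_t⁻¹ ∘ Ψ_t ∘ f_0` with smoothed time in `f_t`;
joint smoothness of such inverses comes from `contMDiff_of_family_comp_eq`. -/

/-! ### Parametric integrals and Hadamard's lemma. -/

/-- Integrating a smooth family over a compact time interval gives a smooth function of the
parameter. -/
theorem contDiff_parametric_intervalIntegral {X : Type} [NormedAddCommGroup X] [NormedSpace ℝ X]
    [FiniteDimensional ℝ X] (n : ℕ) :
    ∀ {Y : Type} [NormedAddCommGroup Y] [NormedSpace ℝ Y] [CompleteSpace Y] {f : ℝ × X → Y},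
      ContDiff ℝ n f → ContDiff ℝ n (fun x => ∫ s in (0 : ℝ)..1, f (s, x)) := by
  -- `Y` stays quantified inside the induction, since the derivative takes values in `X →L[ℝ] Y`.
  induction n with
  | zero =>
    intro Y _ _ _ f hf
    have hc : Continuous f := hf.continuous
    refine contDiff_zero.2 ?_
    exact intervalIntegral.continuous_parametric_intervalIntegral_of_continuous'
      (f := fun x s => f (s, x)) (μ := MeasureTheory.volume) (by fun_prop) 0 1
  | succ n ih =>
    intro Y _ _ _ f hf
    have hf' : ContDiff ℝ n (fun q : ℝ × X =>
        (fderiv ℝ f q).comp (ContinuousLinearMap.inr ℝ ℝ X)) :=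
      (hf.fderiv_right (m := n) (by norm_cast)).clm_comp contDiff_const
    have hfd : ∀ s x, HasFDerivAt (fun x => f (s, x))
        ((fderiv ℝ f (s, x)).comp (ContinuousLinearMap.inr ℝ ℝ X)) x := by
      intro s x
      have h1 : DifferentiableAt ℝ f (s, x) :=
        hf.contDiffAt.differentiableAt (by simp)
      exact h1.hasFDerivAt.comp (f := fun x : X => (s, x)) x (hasFDerivAt_prodMk_right s x)
    have key : ∀ x₀, HasFDerivAt (fun x => ∫ s in (0 : ℝ)..1, f (s, x))
        (∫ s in (0 : ℝ)..1, (fderiv ℝ f (s, x₀)).comp (ContinuousLinearMap.inr ℝ ℝ X)) x₀ := by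
      intro x₀
      have hK : IsCompact (Icc (0 : ℝ) 1 ×ˢ Metric.closedBall x₀ 1) :=
        isCompact_Icc.prod (isCompact_closedBall x₀ 1)
      obtain ⟨C, hC⟩ := hK.exists_bound_of_continuousOn hf'.continuous.continuousOn
      refine (intervalIntegral.hasFDerivAt_integral_of_dominated_of_fderiv_le (𝕜 := ℝ)
        (F := fun x s => f (s, x)) (μ := MeasureTheory.volume) (a := 0) (b := 1)
        (F' := fun x s => (fderiv ℝ f (s, x)).comp (ContinuousLinearMap.inr ℝ ℝ X))
        (bound := fun _ => C) (Metric.closedBall_mem_nhds x₀ one_pos)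
        ?_ ?_ ?_ ?_ ?_ ?_)
      · refine Eventually.of_forall fun x => ?_
        exact (hf.continuous.comp (by fun_prop)).aestronglyMeasurable
      · exact (hf.continuous.comp (by fun_prop)).intervalIntegrable _ _
      · exact (hf'.continuous.comp (by fun_prop : Continuous fun s : ℝ => (s, x₀))
          ).aestronglyMeasurable
      · refine Eventually.of_forall fun s hs x hx => hC (s, x) ⟨?_, hx⟩
        rw [uIoc_of_le zero_le_one] at hs
        exact ⟨hs.1.le, hs.2⟩
      · exact intervalIntegrable_const
      · exact Eventually.of_forall fun s _ x _ => hfd s x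
    push_cast
    rw [contDiff_succ_iff_fderiv]
    refine ⟨fun x => (key x).differentiableAt, by simp, ?_⟩
    rw [funext fun x => (key x).fderiv]
    exact ih hf'

/-- Hadamard's lemma: a smooth function vanishing on the hyperplane `l = 0` is, locally, a smooth
multiple of `l`. -/
theorem exists_contDiff_eq_mul {X : Type} [NormedAddCommGroup X] [NormedSpace ℝ X]
    [FiniteDimensional ℝ X] (l : X →L[ℝ] ℝ) {e : X} (he : l e = 1) {x₀ : X}
    {A : X → ℝ} {U : Set X} (hU : U ∈ 𝓝 x₀) (hA : ContDiffOn ℝ ∞ A U)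
    (hA0 : ∀ x ∈ U, l x = 0 → A x = 0) :
    ∃ G : X → ℝ, ContDiff ℝ ∞ G ∧ ∀ᶠ x in 𝓝 x₀, A x = l x * G x := by
  obtain ⟨ε, hε, hεU⟩ := Metric.mem_nhds_iff.1 hU
  -- Cutting `A` off inside `U` gives a globally smooth `B` vanishing on the whole hyperplane, so
  -- that the segments used below may leave `U`.
  let ψ : ContDiffBump x₀ := ⟨ε / 4, ε / 2, by positivity, by linarith⟩
  have hB : ContDiff ℝ ∞ fun x => ψ x * A x := by
    rw [contDiff_iff_contDiffAt]
    intro x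
    by_cases hx : x ∈ Metric.ball x₀ ε
    · exact ψ.contDiffAt.mul ((hA.mono hεU).contDiffAt (Metric.isOpen_ball.mem_nhds hx))
    · have : x ∉ tsupport ψ := by
        rw [ψ.tsupport_eq]
        intro h
        refine hx (Metric.closedBall_subset_ball ?_ h)
        change ε / 2 < ε
        linarith
      have h0 : (fun x => ψ x * A x) =ᶠ[𝓝 x] fun _ => 0 := by
        filter_upwards [notMem_tsupport_iff_eventuallyEq.1 this] with y hy
        simp [hy]
      exact contDiffAt_const.congr_of_eventuallyEq h0
  set B : X → ℝ := fun x => ψ x * A x with hBdef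
  have hB0 : ∀ x, l x = 0 → B x = 0 := by
    intro x hx
    by_cases h : x ∈ U
    · simp [hBdef, hA0 x h hx]
    · have : ψ x = 0 := by
        refine ψ.zero_of_le_dist ?_
        by_contra hlt
        push Not at hlt
        refine h (hεU (Metric.mem_ball.2 (hlt.trans ?_)))
        change ε / 2 < ε
        linarith
      simp [hBdef, this]
  -- The segment from the projection of `x` to `ker l` along `e` (time 0) to `x` (time 1); its
  -- velocity is `l x • e`, which produces the factor `l x`.
  let γ : ℝ × X → X := fun q => q.2 - l q.2 • e + (q.1 * l q.2) • e
  have hγ : ContDiff ℝ ∞ γ := by fun_prop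
  let D : ℝ × X → ℝ := fun q => fderiv ℝ B (γ q) e
  have hD : ContDiff ℝ ∞ D :=
    ((hB.fderiv_right (m := ∞) (by simp)).comp hγ).clm_apply contDiff_const
  refine ⟨fun x => ∫ s in (0 : ℝ)..1, D (s, x), ?_, ?_⟩
  · exact contDiff_infty.2 fun n => contDiff_parametric_intervalIntegral n
      (hD.of_le (by exact_mod_cast le_top))
  · have hfull : ∀ x, B x = l x * ∫ s in (0 : ℝ)..1, D (s, x) := by
      intro x
      have hder : ∀ s ∈ uIcc (0 : ℝ) 1, HasDerivAt (fun s => B (γ (s, x))) (l x * D (s, x)) s := by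
        intro s _
        have h1 : HasDerivAt (fun s : ℝ => γ (s, x)) (l x • e) s := by
          have := (((hasDerivAt_id s).mul_const (l x)).smul_const e).const_add (x - l x • e)
          simpa [γ] using this
        have h2 : DifferentiableAt ℝ B (γ (s, x)) := hB.contDiffAt.differentiableAt (by simp)
        have := h2.hasFDerivAt.comp_hasDerivAt s h1
        simpa [D, Function.comp_def] using this
      have hint : IntervalIntegrable (fun s => l x * D (s, x)) MeasureTheory.volume 0 1 :=
        (continuous_const.mul (hD.continuous.comp (by fun_prop))).intervalIntegrable _ _
      have := intervalIntegral.integral_eq_sub_of_hasDerivAt hder hint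
      rw [intervalIntegral.integral_const_mul] at this
      rw [this]
      have h0 : B (γ (0, x)) = 0 := hB0 _ (by simp [γ, he])
      have h1 : γ (1, x) = x := by simp [γ]
      rw [h0, h1, sub_zero]
    filter_upwards [ψ.eventuallyEq_one] with x hx
    rw [← hfull x]
    simp [hBdef, hx]

/-! ### Smooth lifts through injective local diffeomorphisms. -/

section Lift

variable {E : Type*} [NormedAddCommGroup E] [NormedSpace ℝ E] [FiniteDimensional ℝ E]
  {H : Type*} [TopologicalSpace H] {I : ModelWithCorners ℝ E H} [I.Boundaryless]
  {E' : Type*} [NormedAddCommGroup E'] [NormedSpace ℝ E'] [FiniteDimensional ℝ E']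
  {H' : Type*} [TopologicalSpace H'] {I' : ModelWithCorners ℝ E' H'}
  {E₁ : Type*} [NormedAddCommGroup E₁] [NormedSpace ℝ E₁] [FiniteDimensional ℝ E₁]
  {H₁ : Type*} [TopologicalSpace H₁] {I₁ : ModelWithCorners ℝ E₁ H₁} [I₁.Boundaryless]
  {E₂ : Type*} [NormedAddCommGroup E₂] [NormedSpace ℝ E₂]
  {H₂ : Type*} [TopologicalSpace H₂] {I₂ : ModelWithCorners ℝ E₂ H₂}
  {M : Type*} [TopologicalSpace M] [ChartedSpace H M] [IsManifold I ∞ M]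
  {N : Type*} [TopologicalSpace N] [ChartedSpace H' N]
  {P : Type*} [TopologicalSpace P] [ChartedSpace H₁ P] [IsManifold I₁ ∞ P]
  {Q : Type*} [TopologicalSpace Q] [ChartedSpace H₂ Q]

/-- The inverse function theorem on manifolds: a smooth map with injective differential at a point,
between manifolds of the same dimension, has a smooth local right inverse. -/
theorem exists_contMDiffAt_rightInverse (hdim : Module.finrank ℝ E = Module.finrank ℝ E')
    {K : M → N} {x₀ : M} (hK : ContMDiffAt I I' ∞ K x₀)
    (hinj : ∀ v : TangentSpace I x₀, mfderiv I I' K x₀ v = 0 → v = 0) :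
    ∃ G : N → M, ContMDiffAt I' I ∞ G (K x₀) ∧ ∀ᶠ w in 𝓝 (K x₀), K (G w) = w := by
  have hk := (contMDiffAt_iff.1 hK).2
  rw [I.range_eq_univ, contDiffWithinAt_univ] at hk
  set k : E → E' := extChartAt I' (K x₀) ∘ K ∘ (extChartAt I x₀).symm with hkdef
  set y₀ : E := extChartAt I x₀ x₀ with hy₀
  have hky : k y₀ = extChartAt I' (K x₀) (K x₀) := by simp [hkdef, hy₀]
  have hdk : DifferentiableAt ℝ k y₀ := hk.differentiableAt (by simp)
  have hmf : ∀ v : E, fderiv ℝ k y₀ v = 0 → v = 0 := by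
    intro v hv
    refine hinj v ?_
    have : mfderiv I I' K x₀ = fderivWithin ℝ k (range I) y₀ :=
      (hK.mdifferentiableAt (by simp)).mfderiv
    rw [this, I.range_eq_univ, fderivWithin_univ]
    exact hv
  have hinj' : Function.Injective (fderiv ℝ k y₀).toLinearMap :=
    (injective_iff_map_eq_zero _).2 hmf
  let e : E ≃L[ℝ] E' :=
    (LinearEquiv.ofInjectiveOfFinrankEq (fderiv ℝ k y₀).toLinearMap hinj' hdim).toContinuousLinearEquiv
  have he : HasFDerivAt k (e : E →L[ℝ] E') y₀ := by
    have : (e : E →L[ℝ] E') = fderiv ℝ k y₀ := by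
      ext v; rfl
    rw [this]
    exact hdk.hasFDerivAt
  have hsmooth := hk.to_localInverse he (by simp)
  have hright := (hk.hasStrictFDerivAt' he (by simp)).eventually_right_inverse
  have hval := hk.localInverse_apply_image he (by simp)
  change ∀ᶠ w in 𝓝 (k y₀), k (hk.localInverse he (by simp) w) = w at hright
  set g : E' → E := hk.localInverse he (by simp) with hg
  have hcomp : ContMDiffAt I' I ∞ (fun w => (extChartAt I x₀).symm (g (extChartAt I' (K x₀) w)))
      (K x₀) := by
    have h1 : ContMDiffAt I' 𝓘(ℝ, E') ∞ (extChartAt I' (K x₀)) (K x₀) := contMDiffAt_extChartAt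
    have h2 : ContMDiffAt 𝓘(ℝ, E') 𝓘(ℝ, E) ∞ g (extChartAt I' (K x₀) (K x₀)) := by
      rw [← hky]; exact hsmooth.contMDiffAt
    have h3 : ContMDiffAt 𝓘(ℝ, E) I ∞ (extChartAt I x₀).symm (g (extChartAt I' (K x₀) (K x₀))) := by
      rw [← hky, hval]
      have := contMDiffOn_extChartAt_symm (I := I) (n := ∞) x₀
      exact this.contMDiffAt (extChartAt_target_mem_nhds x₀)
    exact h3.comp (K x₀) (h2.comp (K x₀) h1)
  refine ⟨_, hcomp, ?_⟩
  have hsrc : ∀ᶠ w in 𝓝 (K x₀), w ∈ (extChartAt I' (K x₀)).source := extChartAt_source_mem_nhds _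
  have hb : (extChartAt I x₀).symm (g (extChartAt I' (K x₀) (K x₀))) = x₀ := by
    rw [← hky, hval, hy₀, extChartAt_to_inv]
  -- The chart of `N` is injective only on its source, so `K (G w)` must be known to lie there
  -- before coordinates can be compared.
  have hsrc' : ∀ᶠ w in 𝓝 (K x₀),
      K ((extChartAt I x₀).symm (g (extChartAt I' (K x₀) w))) ∈ (extChartAt I' (K x₀)).source := by
    have hc : ContinuousAt (fun w => K ((extChartAt I x₀).symm (g (extChartAt I' (K x₀) w))))
        (K x₀) := by
      refine ContinuousAt.comp (g := K) ?_ hcomp.continuousAt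
      rw [hb]; exact hK.continuousAt
    refine hc (extChartAt_source_mem_nhds' ?_)
    beta_reduce
    rw [hb]
    exact mem_extChartAt_source _
  have hr : ∀ᶠ w in 𝓝 (K x₀), k (g (extChartAt I' (K x₀) w)) = extChartAt I' (K x₀) w := by
    rw [hky] at hright
    exact (continuousAt_extChartAt (I := I') (K x₀)).eventually hright
  filter_upwards [hsrc, hsrc', hr] with w h1 h2 h3
  exact (extChartAt I' (K x₀)).injOn h2 h1 h3

/-- A map lifting a smooth map through an injective local diffeomorphism is smooth. -/
theorem contMDiff_of_comp_eq (hdim : Module.finrank ℝ E = Module.finrank ℝ E')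
    {K : M → N} (hK : ContMDiff I I' ∞ K) (hinj : Function.Injective K)
    (hd : ∀ (x : M) (v : TangentSpace I x), mfderiv I I' K x v = 0 → v = 0)
    {L : Q → N} (hL : ContMDiff I₂ I' ∞ L) {g : Q → M} (hg : ∀ q, K (g q) = L q) :
    ContMDiff I₂ I ∞ g := by
  intro q
  -- Global injectivity of `K` forces `g = G ∘ L` near `q`; continuity of `g` is a consequence and
  -- is not needed beforehand.
  obtain ⟨G, hG, hKG⟩ := exists_contMDiffAt_rightInverse hdim (hK (g q)) (hd (g q))
  rw [hg] at hG hKG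
  refine (hG.comp q (hL q)).congr_of_eventuallyEq ?_
  filter_upwards [(hL q).continuousAt.eventually hKG] with q' hq'
  exact hinj (by rw [hg, Function.comp_apply, hq'])

/-- A map lifting a smooth map through a smooth family of injective local diffeomorphisms is
smooth. -/
theorem contMDiff_of_family_comp_eq (hdim : Module.finrank ℝ E = Module.finrank ℝ E')
    {k : P × M → N} (hk : ContMDiff (I₁.prod I) I' ∞ k)
    (hinj : ∀ p, Function.Injective fun x => k (p, x))
    (hd : ∀ (p : P) (x : M) (v : TangentSpace I x),
      mfderiv I I' (fun x => k (p, x)) x v = 0 → v = 0)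
    {L : Q → N} (hL : ContMDiff I₂ I' ∞ L) {b : Q → P} (hb : ContMDiff I₂ I₁ ∞ b)
    {g : Q → M} (hg : ∀ q, k (b q, g q) = L q) :
    ContMDiff I₂ I ∞ g := by
  -- The parameter is kept as an extra coordinate: `(p, x) ↦ (p, k (p, x))` is a single injective
  -- map with injective differential between manifolds of equal dimension.
  have h : ContMDiff I₂ (I₁.prod I) ∞ fun q => (b q, g q) := by
    refine contMDiff_of_comp_eq (I := I₁.prod I) (I' := I₁.prod I') (E' := E₁ × E')
      (N := P × N) (K := fun q : P × M => (q.1, k q)) (L := fun q => (b q, L q)) ?_ ?_ ?_ ?_ ?_ ?_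
    · simp [hdim]
    · exact contMDiff_fst.prodMk hk
    · rintro ⟨p, x⟩ ⟨p', x'⟩ h
      obtain ⟨h1, h2⟩ := Prod.mk.inj h
      obtain rfl : p = p' := h1
      rw [hinj p h2]
    · rintro ⟨p, x⟩ v hv
      have hkd : MDifferentiableAt (I₁.prod I) I' k (p, x) := (hk _).mdifferentiableAt (by simp)
      rw [mfderiv_prodMk mdifferentiableAt_fst hkd] at hv
      have h1 : mfderiv (I₁.prod I) I₁ Prod.fst (p, x) v = 0 := congrArg Prod.fst hv
      have h2 : mfderiv (I₁.prod I) I' k (p, x) v = 0 := congrArg Prod.snd hv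
      rw [mfderiv_fst] at h1
      have h1' : v.1 = 0 := h1
      rw [mfderiv_prod_eq_add_apply hkd] at h2
      have h0 : mfderiv I₁ I' (fun z => k (z, x)) p v.1 = 0 :=
        (congrArg (mfderiv I₁ I' (fun z => k (z, x)) p) h1').trans (map_zero _)
      have h3 : v.2 = 0 := by
        refine hd p x v.2 ?_
        have h4 : mfderiv I₁ I' (fun z => k (z, x)) p v.1 +
          mfderiv I I' (fun z => k (p, z)) x v.2 = 0 := h2
        rwa [h0, zero_add] at h4
      exact Prod.ext h1' h3
    · exact hb.prodMk hL
    · intro q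
      simp [hg]
  exact h.snd

end Lift

/-! ### Radial maps of the disk defined by a profile. -/

section DiskProfile

/-- A positive smooth function `a` on the unit disk for which `r² a` is strictly increasing along
rays. -/
structure IsDiskProfile (a : ℂ → ℝ) : Prop where
  contDiffOn : ContDiffOn ℝ ∞ a (Metric.ball 0 1)
  pos : ∀ z ∈ Metric.ball (0 : ℂ) 1, 0 < a z
  radial : ∀ z ∈ Metric.ball (0 : ℂ) 1, 0 < 2 * a z + fderiv ℝ a z z

/-- The radial map which pulls back `x dy - y dx` to `a (x dy - y dx)`. -/
def spread (a : ℂ → ℝ) (z : ℂ) : ℂ := √(a z) • z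

namespace IsDiskProfile

variable {a b : ℂ → ℝ}

theorem hasFDerivAt (ha : IsDiskProfile a) {z : ℂ} (hz : z ∈ Metric.ball (0 : ℂ) 1) :
    HasFDerivAt a (fderiv ℝ a z) z :=
  ((ha.contDiffOn.contDiffAt (Metric.isOpen_ball.mem_nhds hz)).differentiableAt
    (by simp)).hasFDerivAt

/-- The derivative of `r² a` along the ray is `r (2a + da(z) z)` with `z = r e`, which is where the
condition `radial` comes from. -/
theorem strictMonoOn (ha : IsDiskProfile a) {e : ℂ} (he : ‖e‖ = 1) :
    StrictMonoOn (fun r : ℝ => r ^ 2 * a (r • e)) (Ico 0 1) := by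
  have hmem : ∀ r ∈ Ico (0 : ℝ) 1, r • e ∈ Metric.ball (0 : ℂ) 1 := by
    intro r hr
    rw [mem_ball_zero_iff, norm_smul, he, mul_one, Real.norm_of_nonneg hr.1]
    exact hr.2
  have hder : ∀ r ∈ Ico (0 : ℝ) 1, HasDerivAt (fun r : ℝ => r ^ 2 * a (r • e))
      (r * (2 * a (r • e) + fderiv ℝ a (r • e) (r • e))) r := by
    intro r hr
    have h1 : HasDerivAt (fun r : ℝ => r • e) e r := by
      simpa using (hasDerivAt_id r).smul_const e
    have h2 := (ha.hasFDerivAt (hmem r hr)).comp_hasDerivAt r h1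
    rw [map_smul, smul_eq_mul]
    convert! (hasDerivAt_pow 2 r).mul h2 using 1
    simp
    ring
  refine strictMonoOn_of_deriv_pos (convex_Ico 0 1)
    (fun r hr => (hder r hr).continuousAt.continuousWithinAt) ?_
  intro r hr
  rw [interior_Ico] at hr
  have hr' : r ∈ Ico (0 : ℝ) 1 := ⟨hr.1.le, hr.2⟩
  rw [(hder r hr').deriv]
  exact mul_pos hr.1 (ha.radial _ (hmem r hr'))

/-- Each ray is mapped into itself, and on it the squared modulus of the image is the strictly
increasing function `r² a`. -/
theorem injOn_spread (ha : IsDiskProfile a) : InjOn (spread a) (Metric.ball 0 1) := by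
  intro z hz w hw h
  have key : ∀ z ∈ Metric.ball (0 : ℂ) 1, spread a z = 0 → z = 0 := by
    intro z hz h
    exact (smul_eq_zero.1 h).resolve_left (Real.sqrt_pos.2 (ha.pos z hz)).ne'
  by_cases hz0 : z = 0
  · subst hz0
    have : spread a w = 0 := by rw [← h]; simp [spread]
    exact (key w hw this).symm
  have hzn : 0 < ‖z‖ := norm_pos_iff.2 hz0
  have hsz := Real.sqrt_pos.2 (ha.pos z hz)
  have hsw := Real.sqrt_pos.2 (ha.pos w hw)
  set e : ℂ := ‖z‖⁻¹ • z with he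
  have he1 : ‖e‖ = 1 := by
    rw [he, norm_smul, norm_inv, norm_norm, inv_mul_cancel₀ hzn.ne']
  have hze : z = ‖z‖ • e := by rw [he, smul_inv_smul₀ hzn.ne']
  have hnorm : √(a z) * ‖z‖ = √(a w) * ‖w‖ := by
    have := congrArg norm h
    simpa [spread, abs_of_pos hsz, abs_of_pos hsw] using this
  have hwe : w = ‖w‖ • e := by
    have h1 : w = (√(a w))⁻¹ • √(a z) • z := by
      rw [show √(a z) • z = √(a w) • w from h, inv_smul_smul₀ hsw.ne']
    have h2 : ‖w‖ = (√(a w))⁻¹ * (√(a z) * ‖z‖) := by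
      rw [hnorm, inv_mul_cancel_left₀ hsw.ne']
    rw [h2, mul_smul, mul_smul, ← hze]
    exact h1
  have hsq : ‖z‖ ^ 2 * a (‖z‖ • e) = ‖w‖ ^ 2 * a (‖w‖ • e) := by
    rw [← hze, ← hwe, ← Real.sq_sqrt (ha.pos z hz).le, ← Real.sq_sqrt (ha.pos w hw).le,
      ← mul_pow, ← mul_pow, mul_comm, hnorm, mul_comm]
  have := (ha.strictMonoOn he1).injOn ⟨norm_nonneg z, mem_ball_zero_iff.1 hz⟩
    ⟨norm_nonneg w, mem_ball_zero_iff.1 hw⟩ hsq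
  rw [hze, hwe, this]

theorem hasFDerivAt_spread (ha : IsDiskProfile a) {z : ℂ} (hz : z ∈ Metric.ball (0 : ℂ) 1) :
    HasFDerivAt (spread a) (√(a z) • ContinuousLinearMap.id ℝ ℂ +
      ((1 / (2 * √(a z))) • fderiv ℝ a z).smulRight z) z :=
  ((ha.hasFDerivAt hz).sqrt (ha.pos z hz).ne').smul (hasFDerivAt_id z)

/-- A vector in the kernel must be radial, `v = c z`, and the derivative in the radial direction
leaves `c (2a + da(z) z) = 0`. -/
theorem fderiv_spread_injective (ha : IsDiskProfile a) {z : ℂ}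
    (hz : z ∈ Metric.ball (0 : ℂ) 1) {v : ℂ} (hv : fderiv ℝ (spread a) z v = 0) : v = 0 := by
  rw [(ha.hasFDerivAt_spread hz).fderiv] at hv
  have hs := Real.sqrt_pos.2 (ha.pos z hz)
  set S := √(a z) with hS
  set c : ℝ := S⁻¹ * -(1 / (2 * S) * fderiv ℝ a z v) with hc
  have hv' : S • v + (1 / (2 * S) * fderiv ℝ a z v) • z = 0 := by simpa using hv
  have hvc : v = c • z := by
    rw [hc, mul_smul, neg_smul, ← eq_neg_of_add_eq_zero_left hv', inv_smul_smul₀ hs.ne']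
  have hcc : c * (2 * a z + fderiv ℝ a z z) = 0 := by
    have h1 : fderiv ℝ a z v = c * fderiv ℝ a z z := by
      conv_lhs => rw [hvc]
      rw [map_smul, smul_eq_mul]
    have h2 : a z = S ^ 2 := (Real.sq_sqrt (ha.pos z hz).le).symm
    rw [h1] at hc
    rw [h2]
    field_simp at hc
    linarith
  have : c = 0 := (mul_eq_zero.1 hcc).resolve_right (ha.radial z hz).ne'
  rw [hvc, this, zero_smul]

/-- On the ray through `z`, the value of `r² a` at `‖z‖` lies below its value at some larger radius
where `a = b`. The intermediate value theorem applied to `r² b` on the segment up to that radius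
finds the preimage. Agreement near each single boundary point is enough. -/
theorem exists_spread_eq (ha : IsDiskProfile a) (hb : IsDiskProfile b)
    (hab : ∀ e : ℂ, ‖e‖ = 1 → ∀ᶠ z in 𝓝 e, ‖z‖ < 1 → a z = b z) {z : ℂ}
    (hz : z ∈ Metric.ball (0 : ℂ) 1) : ∃ w ∈ Metric.ball (0 : ℂ) 1, spread b w = spread a z := by
  by_cases hz0 : z = 0
  · exact ⟨0, by simp, by simp [spread, hz0]⟩
  have hzn : 0 < ‖z‖ := norm_pos_iff.2 hz0
  have hz1 : ‖z‖ < 1 := mem_ball_zero_iff.1 hz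
  set e : ℂ := ‖z‖⁻¹ • z with he
  have he1 : ‖e‖ = 1 := by
    rw [he, norm_smul, norm_inv, norm_norm, inv_mul_cancel₀ hzn.ne']
  have hze : z = ‖z‖ • e := by rw [he, smul_inv_smul₀ hzn.ne']
  have hmem : ∀ r ∈ Ico (0 : ℝ) 1, r • e ∈ Metric.ball (0 : ℂ) 1 := by
    intro r hr
    rw [mem_ball_zero_iff, norm_smul, he1, mul_one, Real.norm_of_nonneg hr.1]
    exact hr.2
  obtain ⟨r, hr, hrab⟩ : ∃ r ∈ Ioo ‖z‖ 1, a (r • e) = b (r • e) := by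
    have ht : Tendsto (fun r : ℝ => r • e) (𝓝[<] 1) (𝓝 e) := by
      have : Tendsto (fun r : ℝ => r • e) (𝓝 1) (𝓝 ((1 : ℝ) • e)) :=
        (continuous_id.smul continuous_const).tendsto 1
      rw [one_smul] at this
      exact this.mono_left nhdsWithin_le_nhds
    obtain ⟨r, h1, h2⟩ := ((ht.eventually (hab e he1)).and (Ioo_mem_nhdsLT hz1)).exists
    exact ⟨r, h2, h1 (mem_ball_zero_iff.1 (hmem r ⟨hzn.le.trans h2.1.le, h2.2⟩))⟩
  have hr0 : 0 ≤ r := hzn.le.trans hr.1.le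
  have hcont : ContinuousOn (fun s : ℝ => s ^ 2 * b (s • e)) (Icc 0 r) := by
    refine (continuous_pow 2).continuousOn.mul (hb.contDiffOn.continuousOn.comp
      (by fun_prop) ?_)
    exact fun s hs => hmem s ⟨hs.1, hs.2.trans_lt hr.2⟩
  have hle : ‖z‖ ^ 2 * a (‖z‖ • e) ≤ r ^ 2 * b (r • e) := by
    rw [← hrab]
    exact (ha.strictMonoOn he1).monotoneOn ⟨hzn.le, hz1⟩ ⟨hr0, hr.2⟩ hr.1.le
  obtain ⟨s, hs, hsv⟩ := intermediate_value_Icc hr0 hcont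
    (show ‖z‖ ^ 2 * a (‖z‖ • e) ∈ Icc _ _ from
      ⟨by simpa using mul_nonneg (sq_nonneg ‖z‖) (ha.pos (‖z‖ • e) (by rwa [← hze])).le, hle⟩)
  have hsm := hmem s ⟨hs.1, hs.2.trans_lt hr.2⟩
  refine ⟨s • e, hsm, ?_⟩
  have h1 : √(b (s • e)) * s = √(a z) * ‖z‖ := by
    have h2 := congrArg Real.sqrt hsv
    simp only [Real.sqrt_mul (sq_nonneg _), Real.sqrt_sq hs.1, Real.sqrt_sq hzn.le, ← hze] at h2
    linarith
  rw [spread, spread, ← mul_smul, h1, mul_smul, ← hze]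

end IsDiskProfile

end DiskProfile

/-! ### The open disk as a manifold with its inclusion into the plane. -/

section Disk

theorem coe_extChartAt_disk_symm (z₀ : disk) {y : ℂ} (hy : y ∈ (extChartAt 𝓘(ℝ, ℂ) z₀).target) :
    (((extChartAt 𝓘(ℝ, ℂ) z₀).symm y : disk) : ℂ) = y :=
  (extChartAt 𝓘(ℝ, ℂ) z₀).right_inv hy

theorem contMDiff_disk_coe : ContMDiff 𝓘(ℝ, ℂ) 𝓘(ℝ, ℂ) ∞ (fun z : disk => (z : ℂ)) :=
  contMDiff_subtype_val

theorem hasMFDerivAt_disk_coe (z : disk) :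
    HasMFDerivAt 𝓘(ℝ, ℂ) 𝓘(ℝ, ℂ) (fun w : disk => (w : ℂ)) z (ContinuousLinearMap.id ℝ ℂ) := by
  refine ⟨continuous_subtype_val.continuousAt, ?_⟩
  have : writtenInExtChartAt 𝓘(ℝ, ℂ) 𝓘(ℝ, ℂ) z (fun w : disk => (w : ℂ))
      =ᶠ[𝓝 (extChartAt 𝓘(ℝ, ℂ) z z)] id := by
    filter_upwards [extChartAt_target_mem_nhds (I := 𝓘(ℝ, ℂ)) z] with y hy
    exact coe_extChartAt_disk_symm z hy
  exact ((hasFDerivAt_id _).congr_of_eventuallyEq this).hasFDerivWithinAt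

theorem mfderiv_comp_disk_coe {f : ℂ → ℂ} {z : disk} (hf : DifferentiableAt ℝ f z)
    (v : TangentSpace 𝓘(ℝ, ℂ) z) :
    mfderiv 𝓘(ℝ, ℂ) 𝓘(ℝ, ℂ) (fun w : disk => f w) z v = fderiv ℝ f z v := by
  have h := (hf.hasFDerivAt.hasMFDerivAt).comp z (hasMFDerivAt_disk_coe z)
  exact congrArg (fun T : ℂ →L[ℝ] ℂ => T v) h.mfderiv

end Disk

/-! ### Smooth families of profiles and the radial isotopy between them. -/

/-- The positivity and monotonicity conditions are strict linear inequalities in the profile; this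
is what makes a straight-line path available. -/
theorem IsDiskProfile.convexComb {a b : ℂ → ℝ} (ha : IsDiskProfile a)
    (hb : IsDiskProfile b) {s : ℝ} (hs0 : 0 ≤ s) (hs1 : s ≤ 1) :
    IsDiskProfile fun z => (1 - s) * a z + s * b z := by
  have hpos : ∀ x y : ℝ, 0 < x → 0 < y → 0 < (1 - s) * x + s * y := by
    intro x y hx hy
    rcases hs0.eq_or_lt with rfl | hs
    · simpa
    · have := mul_nonneg (sub_nonneg.2 hs1) hx.le
      have := mul_pos hs hy
      linarith
  refine ⟨?_, fun z hz => hpos _ _ (ha.pos z hz) (hb.pos z hz), fun z hz => ?_⟩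
  · exact (contDiffOn_const.mul ha.contDiffOn).add (contDiffOn_const.mul hb.contDiffOn)
  · have h := ((ha.hasFDerivAt hz).const_mul (1 - s)).add ((hb.hasFDerivAt hz).const_mul s)
    have h' : HasFDerivAt (fun z => (1 - s) * a z + s * b z) _ z := h
    rw [h'.fderiv]
    have := hpos _ _ (ha.radial z hz) (hb.radial z hz)
    simp only [add_apply, smul_apply, smul_eq_mul]
    linarith

/-- The linear interpolation of two profiles, with smoothed time. -/
def interpolation {P : Type*} (g₀ g₁ : P × ℂ → ℝ) (q : (ℝ × P) × ℂ) : ℝ :=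
  (1 - Real.smoothTransition q.1.1) * g₀ (q.1.2, q.2) +
    Real.smoothTransition q.1.1 * g₁ (q.1.2, q.2)

section Profile

variable {E : Type*} [NormedAddCommGroup E] [NormedSpace ℝ E]
  {H : Type*} [TopologicalSpace H] {I : ModelWithCorners ℝ E H}
  {P : Type*} [TopologicalSpace P] [ChartedSpace H P]
  {E₂ : Type*} [NormedAddCommGroup E₂] [NormedSpace ℝ E₂]
  {H₂ : Type*} [TopologicalSpace H₂] {I₂ : ModelWithCorners ℝ E₂ H₂}
  {Q : Type*} [TopologicalSpace Q] [ChartedSpace H₂ Q]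

variable (I) in
/-- A smooth family of disk profiles parametrized by a manifold. -/
structure IsProfile (g : P × ℂ → ℝ) : Prop where
  smooth : ContMDiffOn (I.prod 𝓘(ℝ, ℂ)) 𝓘(ℝ, ℝ) ∞ g (univ ×ˢ Metric.ball 0 1)
  fiber : ∀ p, IsDiskProfile fun z => g (p, z)

namespace IsProfile

variable {g g₀ g₁ : P × ℂ → ℝ}

theorem contMDiff_coe (hg : IsProfile I g) :
    ContMDiff (I.prod 𝓘(ℝ, ℂ)) 𝓘(ℝ, ℝ) ∞ fun q : P × disk => g (q.1, q.2) := by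
  rw [← contMDiffOn_univ]
  refine hg.smooth.comp (f := fun q : P × disk => (q.1, (q.2 : ℂ)))
    (contMDiff_fst.prodMk (contMDiff_disk_coe.comp contMDiff_snd)).contMDiffOn ?_
  exact fun q _ => ⟨mem_univ _, q.2.2⟩

theorem contMDiff_sqrt (hg : IsProfile I g) :
    ContMDiff (I.prod 𝓘(ℝ, ℂ)) 𝓘(ℝ, ℝ) ∞ fun q : P × disk => √(g (q.1, q.2)) := by
  intro q
  have h : ContDiffAt ℝ ∞ Real.sqrt (g (q.1, q.2)) :=
    Real.contDiffAt_sqrt ((hg.fiber q.1).pos _ q.2.2).ne'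
  exact h.contMDiffAt.comp q (hg.contMDiff_coe q)

theorem contMDiff_spread (hg : IsProfile I g) :
    ContMDiff (I.prod 𝓘(ℝ, ℂ)) 𝓘(ℝ, ℂ) ∞
      fun q : P × disk => spread (fun z => g (q.1, z)) q.2 :=
  hg.contMDiff_sqrt.smul (contMDiff_disk_coe.comp contMDiff_snd)

theorem interpolate (hg₀ : IsProfile I g₀) (hg₁ : IsProfile I g₁) :
    IsProfile (𝓘(ℝ, ℝ).prod I) (interpolation g₀ g₁) := by
  refine ⟨?_, fun p => (hg₀.fiber p.2).convexComb (hg₁.fiber p.2)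
    (Real.smoothTransition.nonneg p.1) (Real.smoothTransition.le_one p.1)⟩
  have hproj : ContMDiff ((𝓘(ℝ, ℝ).prod I).prod 𝓘(ℝ, ℂ)) (I.prod 𝓘(ℝ, ℂ)) ∞
      fun q : (ℝ × P) × ℂ => (q.1.2, q.2) :=
    (contMDiff_snd.comp contMDiff_fst).prodMk contMDiff_snd
  have hχ : ContMDiff ((𝓘(ℝ, ℝ).prod I).prod 𝓘(ℝ, ℂ)) 𝓘(ℝ, ℝ) ∞
      fun q : (ℝ × P) × ℂ => Real.smoothTransition q.1.1 :=
    (Real.smoothTransition.contDiff (n := ⊤)).contMDiff.comp (contMDiff_fst.comp contMDiff_fst)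
  have h₀ := hg₀.smooth.comp (hproj.contMDiffOn (s := univ ×ˢ Metric.ball 0 1))
    fun q hq => ⟨mem_univ _, hq.2⟩
  have h₁ := hg₁.smooth.comp (hproj.contMDiffOn (s := univ ×ˢ Metric.ball 0 1))
    fun q hq => ⟨mem_univ _, hq.2⟩
  exact ((contMDiff_const.sub hχ).contMDiffOn.mul h₀).add (hχ.contMDiffOn.mul h₁)

variable [FiniteDimensional ℝ E] [I.Boundaryless] [IsManifold I ∞ P]

/-- A map to the disk is smooth if its composition with the spreading maps is. -/
theorem contMDiff_of_spread_eq (hg : IsProfile I g) {L : Q → ℂ} (hL : ContMDiff I₂ 𝓘(ℝ, ℂ) ∞ L)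
    {b : Q → P} (hb : ContMDiff I₂ I ∞ b) {w : Q → disk}
    (hw : ∀ q, spread (fun z => g (b q, z)) (w q) = L q) : ContMDiff I₂ 𝓘(ℝ, ℂ) ∞ w := by
  refine contMDiff_of_family_comp_eq (I₁ := I) rfl hg.contMDiff_spread ?_ ?_ hL hb hw
  · intro p z z' h
    exact Subtype.ext ((hg.fiber p).injOn_spread z.2 z'.2 h)
  · intro p z v hv
    refine (hg.fiber p).fderiv_spread_injective z.2 (v := v) ?_
    exact (mfderiv_comp_disk_coe ((hg.fiber p).hasFDerivAt_spread z.2).differentiableAt v).symm.trans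
      hv

/-- Two profiles which agree near the boundary of the disk are related by a radial isotopy. -/
theorem exists_isotopy (hg₀ : IsProfile I g₀) (hg₁ : IsProfile I g₁)
    (h : ∀ (p : P) (e : ℂ), ‖e‖ = 1 → ∀ᶠ z in 𝓝 e, ‖z‖ < 1 → g₀ (p, z) = g₁ (p, z)) :
    ∃ Ψ : ℝ → (P × disk) ≃ₘ⟮I.prod 𝓘(ℝ, ℂ), I.prod 𝓘(ℝ, ℂ)⟯
        (P × disk),
      ContMDiff (𝓘(ℝ, ℝ).prod (I.prod 𝓘(ℝ, ℂ))) (I.prod 𝓘(ℝ, ℂ)) ∞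
        (fun q : ℝ × (P × disk) => Ψ q.1 q.2) ∧
      ∀ t x, (Ψ t x).1 = x.1 ∧
        spread (fun z => interpolation g₀ g₁ ((t, x.1), z)) (Ψ t x).2 =
          spread (fun z => g₀ (x.1, z)) x.2 := by
  have hI := hg₀.interpolate hg₁
  have hmem : ∀ (t : ℝ) (p : P) (e : ℂ), ‖e‖ = 1 → ∀ᶠ z in 𝓝 e, ‖z‖ < 1 →
      g₀ (p, z) = interpolation g₀ g₁ ((t, p), z) := by
    intro t p e he
    filter_upwards [h p e he] with z hz hz1
    rw [interpolation, ← hz hz1]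
    ring
  -- Here `u` will be `S_t⁻¹ ∘ S_0` and `v` its inverse `S_0⁻¹ ∘ S_t`. Injectivity of the spreading
  -- maps makes the choices unique, hence mutually inverse and smooth.
  have hfwd : ∀ q : ℝ × (P × disk), ∃ w : disk,
      spread (fun z => interpolation g₀ g₁ ((q.1, q.2.1), z)) w =
        spread (fun z => g₀ (q.2.1, z)) q.2.2 := by
    intro q
    obtain ⟨w, hw, h1⟩ := (hg₀.fiber q.2.1).exists_spread_eq (hI.fiber (q.1, q.2.1))
      (hmem q.1 q.2.1) q.2.2.2
    exact ⟨⟨w, hw⟩, h1⟩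
  have hbwd : ∀ q : ℝ × (P × disk), ∃ w : disk,
      spread (fun z => g₀ (q.2.1, z)) w =
        spread (fun z => interpolation g₀ g₁ ((q.1, q.2.1), z)) q.2.2 := by
    intro q
    obtain ⟨w, hw, h1⟩ := (hI.fiber (q.1, q.2.1)).exists_spread_eq (hg₀.fiber q.2.1)
      (fun e he => (hmem q.1 q.2.1 e he).mono fun z hz hz1 => (hz hz1).symm) q.2.2.2
    exact ⟨⟨w, hw⟩, h1⟩
  choose u hu using hfwd
  choose v hv using hbwd
  have hassoc : ContMDiff (𝓘(ℝ, ℝ).prod (I.prod 𝓘(ℝ, ℂ))) (𝓘(ℝ, ℝ).prod I) ∞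
      fun q : ℝ × (P × disk) => (q.1, q.2.1) :=
    contMDiff_fst.prodMk (contMDiff_fst.comp contMDiff_snd)
  have hp : ContMDiff (𝓘(ℝ, ℝ).prod (I.prod 𝓘(ℝ, ℂ))) I ∞
      fun q : ℝ × (P × disk) => q.2.1 := contMDiff_fst.comp contMDiff_snd
  have hz : ContMDiff (𝓘(ℝ, ℝ).prod (I.prod 𝓘(ℝ, ℂ))) 𝓘(ℝ, ℂ) ∞
      fun q : ℝ × (P × disk) => q.2.2 := contMDiff_snd.comp contMDiff_snd
  have hus : ContMDiff (𝓘(ℝ, ℝ).prod (I.prod 𝓘(ℝ, ℂ))) 𝓘(ℝ, ℂ) ∞ u :=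
    hI.contMDiff_of_spread_eq (hg₀.contMDiff_spread.comp contMDiff_snd) hassoc hu
  have hvs : ContMDiff (𝓘(ℝ, ℝ).prod (I.prod 𝓘(ℝ, ℂ))) 𝓘(ℝ, ℂ) ∞ v :=
    hg₀.contMDiff_of_spread_eq (hI.contMDiff_spread.comp (hassoc.prodMk hz)) hp hv
  have huv : ∀ t p z, u (t, p, v (t, p, z)) = z := fun t p z =>
    Subtype.ext ((hI.fiber (t, p)).injOn_spread (u (t, p, v (t, p, z))).2 z.2
      ((hu (t, p, v (t, p, z))).trans (hv (t, p, z))))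
  have hvu : ∀ t p z, v (t, p, u (t, p, z)) = z := fun t p z =>
    Subtype.ext ((hg₀.fiber p).injOn_spread (v (t, p, u (t, p, z))).2 z.2
      ((hv (t, p, u (t, p, z))).trans (hu (t, p, z))))
  have hslice : ∀ t : ℝ, ContMDiff (I.prod 𝓘(ℝ, ℂ)) (𝓘(ℝ, ℝ).prod (I.prod 𝓘(ℝ, ℂ))) ∞
      fun x : P × disk => (t, x) := fun t => contMDiff_const.prodMk contMDiff_id
  refine ⟨fun t =>
    { toFun := fun x => (x.1, u (t, x))
      invFun := fun x => (x.1, v (t, x))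
      left_inv := fun x => Prod.ext rfl (hvu t x.1 x.2)
      right_inv := fun x => Prod.ext rfl (huv t x.1 x.2)
      contMDiff_toFun := contMDiff_fst.prodMk (hus.comp (hslice t))
      contMDiff_invFun := contMDiff_fst.prodMk (hvs.comp (hslice t)) }, ?_, ?_⟩
  · exact hp.prodMk hus
  · exact fun t x => ⟨rfl, hu (t, x)⟩

end IsProfile

end Profile

/-! ### The radial form in charts. -/

section Chart

variable {E : Type*} [NormedAddCommGroup E] [NormedSpace ℝ E]
  {H : Type*} [TopologicalSpace H] {I : ModelWithCorners ℝ E H}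
  {F : Type*} [TopologicalSpace F] [ChartedSpace H F]

theorem radialForm_apply (α : OneForm I F) (h : F × ℂ → ℝ) (x : F × disk)
    (v : TangentSpace (I.prod 𝓘(ℝ, ℂ)) x) :
    radialForm α h x v = α x.1 v.1 + h (x.1, (x.2 : ℂ)) * dTheta (x.2 : ℂ) v.2 := by
  have h1 : mfderiv (I.prod 𝓘(ℝ, ℂ)) I (fun y : F × disk => y.1) x v = v.1 := by
    have : mfderiv (I.prod 𝓘(ℝ, ℂ)) I (fun y : F × disk => y.1) x = _ := mfderiv_fst
    rw [this]
    rfl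
  have h2 : mfderiv (I.prod 𝓘(ℝ, ℂ)) 𝓘(ℝ, ℂ) (fun y : F × disk => (y.2 : ℂ)) x v = v.2 := by
    have h3 := (hasMFDerivAt_disk_coe x.2).comp x
      (hasMFDerivAt_snd (I := I) (I' := 𝓘(ℝ, ℂ)) (x := x))
    exact congrArg (fun T : E × ℂ →L[ℝ] ℂ => T v) h3.mfderiv
  have h4 : radialForm α h x v =
      α x.1 (mfderiv (I.prod 𝓘(ℝ, ℂ)) I (fun y : F × disk => y.1) x v) +
      h (x.1, (x.2 : ℂ)) * dTheta (x.2 : ℂ)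
        (mfderiv (I.prod 𝓘(ℝ, ℂ)) 𝓘(ℝ, ℂ) (fun y : F × disk => (y.2 : ℂ)) x v) := rfl
  rw [h4, h1]
  exact congrArg (fun w : ℂ => α x.1 v.1 + h (x.1, (x.2 : ℂ)) * dTheta (x.2 : ℂ) w) h2

variable [I.Boundaryless]

theorem hasMFDerivAt_extChartAt_symm_self (p : F) :
    HasMFDerivAt 𝓘(ℝ, E) I (extChartAt I p).symm (extChartAt I p p)
      (ContinuousLinearMap.id ℝ E) := by
  refine ⟨continuousAt_extChartAt_symm p, ?_⟩
  have h : writtenInExtChartAt 𝓘(ℝ, E) I (extChartAt I p p) (extChartAt I p).symm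
      =ᶠ[𝓝 (extChartAt I p p)] id := by
    filter_upwards [extChartAt_target_mem_nhds (I := I) p] with y hy
    have : writtenInExtChartAt 𝓘(ℝ, E) I (extChartAt I p p) (extChartAt I p).symm y =
      extChartAt I ((extChartAt I p).symm (extChartAt I p p)) ((extChartAt I p).symm y) := rfl
    rw [this, extChartAt_to_inv, (extChartAt I p).right_inv hy]
    rfl
  exact ((hasFDerivAt_id _).congr_of_eventuallyEq h).hasFDerivWithinAt

theorem OneForm.inChart_self (β : OneForm I F) (p : F) (v : E) :
    β.inChart p (extChartAt I p p) v = β p v := by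
  have h1 : β.inChart p (extChartAt I p p) v = β ((extChartAt I p).symm (extChartAt I p p))
      (mfderiv 𝓘(ℝ, E) I (extChartAt I p).symm (extChartAt I p p) v) := rfl
  have h2 : mfderiv 𝓘(ℝ, E) I (extChartAt I p).symm (extChartAt I p p) v = v :=
    congrArg (fun T : E →L[ℝ] E => T v) (hasMFDerivAt_extChartAt_symm_self (I := I) p).mfderiv
  rw [h1, h2]
  have h3 : ∀ q : F, q = p → (β q : E →L[ℝ] ℝ) v = (β p : E →L[ℝ] ℝ) v := by rintro q rfl; rfl
  exact h3 _ (extChartAt_to_inv p)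

variable [IsManifold I ∞ F]

theorem radialForm_inChart (α : OneForm I F) (h : F × ℂ → ℝ) (x : F × disk) {y : E × ℂ}
    (hy : y ∈ (extChartAt (I.prod 𝓘(ℝ, ℂ)) x).target) (v : E × ℂ) :
    (radialForm α h).inChart x y v = α.inChart x.1 y.1 v.1 +
      h ((extChartAt I x.1).symm y.1, y.2) * dTheta y.2 v.2 := by
  have hs : MDifferentiableAt 𝓘(ℝ, E × ℂ) (I.prod 𝓘(ℝ, ℂ))
      (extChartAt (I.prod 𝓘(ℝ, ℂ)) x).symm y :=
    ((contMDiffOn_extChartAt_symm (n := ∞) x).contMDiffAt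
      ((isOpen_extChartAt_target x).mem_nhds hy)).mdifferentiableAt (by simp)
  have hy' := hy
  rw [extChartAt_prod] at hy'
  have hs1 : MDifferentiableAt 𝓘(ℝ, E) I (extChartAt I x.1).symm y.1 :=
    ((contMDiffOn_extChartAt_symm (n := ∞) x.1).contMDiffAt
      ((isOpen_extChartAt_target x.1).mem_nhds hy'.1)).mdifferentiableAt (by simp)
  have h1 : mfderiv (I.prod 𝓘(ℝ, ℂ)) I (fun y : F × disk => y.1)
        ((extChartAt (I.prod 𝓘(ℝ, ℂ)) x).symm y)
        (mfderiv 𝓘(ℝ, E × ℂ) (I.prod 𝓘(ℝ, ℂ)) (extChartAt (I.prod 𝓘(ℝ, ℂ)) x).symm y v) =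
      mfderiv 𝓘(ℝ, E) I (extChartAt I x.1).symm y.1 v.1 := by
    have e1 := (mdifferentiableAt_fst (I := I) (I' := 𝓘(ℝ, ℂ))).hasMFDerivAt.comp y hs.hasMFDerivAt
    have e2 := hs1.hasMFDerivAt.comp y
      (hasFDerivAt_fst (𝕜 := ℝ) (E := E) (F := ℂ) (p := y)).hasMFDerivAt
    have e3 : Prod.fst ∘ (extChartAt (I.prod 𝓘(ℝ, ℂ)) x).symm =
      (extChartAt I x.1).symm ∘ Prod.fst := by
      rw [extChartAt_prod]; rfl
    rw [e3] at e1
    exact congrArg (fun T : E × ℂ →L[ℝ] E => T v) (e1.mfderiv.symm.trans e2.mfderiv)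
  have hsnd : MDifferentiableAt (I.prod 𝓘(ℝ, ℂ)) 𝓘(ℝ, ℂ) (fun y : F × disk => (y.2 : ℂ))
      ((extChartAt (I.prod 𝓘(ℝ, ℂ)) x).symm y) :=
    ((contMDiff_disk_coe.comp contMDiff_snd) _).mdifferentiableAt (by simp)
  have hsndEq : ∀ y ∈ (extChartAt (I.prod 𝓘(ℝ, ℂ)) x).target,
      (((extChartAt (I.prod 𝓘(ℝ, ℂ)) x).symm y).2 : ℂ) = y.2 := by
    intro y hy
    rw [extChartAt_prod] at hy ⊢
    exact coe_extChartAt_disk_symm x.2 hy.2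
  have h2 : mfderiv (I.prod 𝓘(ℝ, ℂ)) 𝓘(ℝ, ℂ) (fun y : F × disk => (y.2 : ℂ))
        ((extChartAt (I.prod 𝓘(ℝ, ℂ)) x).symm y)
        (mfderiv 𝓘(ℝ, E × ℂ) (I.prod 𝓘(ℝ, ℂ)) (extChartAt (I.prod 𝓘(ℝ, ℂ)) x).symm y v) =
      v.2 := by
    have e1 := hsnd.hasMFDerivAt.comp y hs.hasMFDerivAt
    have e2 := (hasFDerivAt_snd (𝕜 := ℝ) (E := E) (F := ℂ) (p := y)).hasMFDerivAt
    have e3 : (fun y : F × disk => (y.2 : ℂ)) ∘ (extChartAt (I.prod 𝓘(ℝ, ℂ)) x).symm =ᶠ[𝓝 y]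
        Prod.snd := by
      filter_upwards [(isOpen_extChartAt_target x).mem_nhds hy] with z hz
      exact hsndEq z hz
    have e4 := e2.congr_of_eventuallyEq e3
    exact congrArg (fun T : E × ℂ →L[ℝ] ℂ => T v) (e1.mfderiv.symm.trans e4.mfderiv)
  have h0 : (radialForm α h).inChart x y v =
      α ((extChartAt (I.prod 𝓘(ℝ, ℂ)) x).symm y).1
        (mfderiv (I.prod 𝓘(ℝ, ℂ)) I (fun y : F × disk => y.1)
        ((extChartAt (I.prod 𝓘(ℝ, ℂ)) x).symm y)
        (mfderiv 𝓘(ℝ, E × ℂ) (I.prod 𝓘(ℝ, ℂ)) (extChartAt (I.prod 𝓘(ℝ, ℂ)) x).symm y v)) +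
      h (((extChartAt (I.prod 𝓘(ℝ, ℂ)) x).symm y).1,
          (((extChartAt (I.prod 𝓘(ℝ, ℂ)) x).symm y).2 : ℂ)) *
        dTheta (((extChartAt (I.prod 𝓘(ℝ, ℂ)) x).symm y).2 : ℂ)
        (mfderiv (I.prod 𝓘(ℝ, ℂ)) 𝓘(ℝ, ℂ) (fun y : F × disk => (y.2 : ℂ))
          ((extChartAt (I.prod 𝓘(ℝ, ℂ)) x).symm y)
          (mfderiv 𝓘(ℝ, E × ℂ) (I.prod 𝓘(ℝ, ℂ)) (extChartAt (I.prod 𝓘(ℝ, ℂ)) x).symm y v)) := rfl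
  have h5 : ((extChartAt (I.prod 𝓘(ℝ, ℂ)) x).symm y).1 = (extChartAt I x.1).symm y.1 := by
    rw [extChartAt_prod]; rfl
  rw [h0, h1, hsndEq y hy]
  have h6 : ∀ (q q' : F), q = q' → ∀ w : E, (α q : E →L[ℝ] ℝ) w = (α q' : E →L[ℝ] ℝ) w := by
    rintro q _ rfl w
    rfl
  refine congrArg₂ (· + ·) (h6 _ _ h5 _) (congrArg₂ (· * ·) ?_ (congrArg (dTheta y.2) h2))
  rw [h5]

end Chart

/-! ### Dividing the radial function by `r²`. -/

section Weight

/-- The area form `(z, w) ↦ Im (conj z * w)`; contracted with `z` in the first slot it is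
`x dy - y dx`. -/
def areaForm (z w : ℂ) : ℝ := z.re * w.im - z.im * w.re

theorem dTheta_apply (z w : ℂ) : dTheta z w = (Complex.normSq z)⁻¹ * areaForm z w := by
  simp [dTheta, areaForm]

theorem normSq_mul_dTheta (z w : ℂ) : Complex.normSq z * dTheta z w = areaForm z w := by
  rw [dTheta_apply]
  by_cases hz : z = 0
  · simp [hz, areaForm]
  · rw [mul_inv_cancel_left₀ (by simpa using hz)]

theorem apply_mul_eq_of_ker_eq {X : Type*} [AddCommGroup X] [Module ℝ X] [TopologicalSpace X]
    {b c : X →L[ℝ] ℝ} (h : ∀ v, b v = 0 ↔ c v = 0) (e v : X) :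
    b v * c e = c v * b e := by
  have h1 : c (c e • v - c v • e) = 0 := by simp [mul_comm]
  have h2 := (h _).2 h1
  simp only [map_sub, map_smul, smul_eq_mul] at h2
  linarith

/-- Both `G` and the area form vanish at `(y₀, 0)`, so their product has zero derivative there. What
survives of `db` is `μ da + dμ ∧ a`, with `a` pulled back from the base, and a disk direction pairs
to zero in it with every vector of `ker a`. -/
theorem exteriorDeriv_eq_zero_of_weight_eq_zero {E : Type*} [NormedAddCommGroup E]
    [NormedSpace ℝ E] {b : E × ℂ → E × ℂ →L[ℝ] ℝ} {a : E → E →L[ℝ] ℝ} {μ G : E × ℂ → ℝ} {y₀ : E}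
    (hb : DifferentiableAt ℝ b (y₀, 0)) (ha : DifferentiableAt ℝ a y₀)
    (hμ : DifferentiableAt ℝ μ (y₀, 0)) (hG : DifferentiableAt ℝ G (y₀, 0)) (hG0 : G (y₀, 0) = 0)
    (hb_eq : ∀ᶠ y in 𝓝 (y₀, (0 : ℂ)), ∀ v, b y v = μ y * (a y.1 v.1 + G y * areaForm y.2 v.2))
    (v : E × ℂ) (hv : a y₀ v.1 = 0) :
    fderiv ℝ b (y₀, 0) (0, 1) v - fderiv ℝ b (y₀, 0) v (0, 1) = 0 := by
  have key : ∀ w v : E × ℂ, fderiv ℝ b (y₀, 0) w v =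
      μ (y₀, 0) * fderiv ℝ a y₀ w.1 v.1 + fderiv ℝ μ (y₀, 0) w * a y₀ v.1 := by
    intro w v
    have hω : HasFDerivAt (fun y : E × ℂ => areaForm y.2 v.2)
        ((v.2.im • Complex.reCLM - v.2.re • Complex.imCLM).comp (ContinuousLinearMap.snd ℝ E ℂ))
        (y₀, 0) := by
      have : (fun y : E × ℂ => areaForm y.2 v.2) = fun y : E × ℂ =>
          ((v.2.im • Complex.reCLM - v.2.re • Complex.imCLM).comp
            (ContinuousLinearMap.snd ℝ E ℂ)) y := by
        funext y
        simp [areaForm, mul_comm]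
      rw [this]
      exact ContinuousLinearMap.hasFDerivAt _
    have haf : HasFDerivAt (fun y : E × ℂ => a y.1 v.1)
        (((fderiv ℝ a y₀).flip v.1).comp (ContinuousLinearMap.fst ℝ E ℂ)) (y₀, 0) := by
      have h1 : HasFDerivAt (fun y : E => a y v.1) ((fderiv ℝ a y₀).flip v.1) y₀ := by
        simpa using ha.hasFDerivAt.clm_apply (hasFDerivAt_const v.1 y₀)
      exact HasFDerivAt.comp (g := fun y : E => a y v.1) (f := Prod.fst) (y₀, (0 : ℂ)) h1
        hasFDerivAt_fst
    have hR := hμ.hasFDerivAt.mul (haf.add (hG.hasFDerivAt.mul hω))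
    have hbv : HasFDerivAt (fun y => b y v) ((fderiv ℝ b (y₀, 0)).flip v) (y₀, 0) := by
      simpa using hb.hasFDerivAt.clm_apply (hasFDerivAt_const v (y₀, (0 : ℂ)))
    have huniq := hbv.unique (hR.congr_of_eventuallyEq (hb_eq.mono fun y hy => hy v))
    have := congrArg (fun T : E × ℂ →L[ℝ] ℝ => T w) huniq
    simpa [hG0, areaForm, mul_comm] using this
  rw [key, key, hv]
  simp

variable {E : Type} [NormedAddCommGroup E] [NormedSpace ℝ E] [FiniteDimensional ℝ E]
  {H : Type*} [TopologicalSpace H] {I : ModelWithCorners ℝ E H} [I.Boundaryless]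
  {F : Type*} [TopologicalSpace F] [ChartedSpace H F] [IsManifold I ∞ F]

/-- If `ker (α + h dθ)` is a contact structure, then near the origin of the disk `h` is `r²` times
a smooth function which does not vanish at the origin. -/
theorem exists_contDiff_weight {α : OneForm I F} (hα : α.IsContactOn univ) {h : F × ℂ → ℝ}
    (hh : ContMDiffOn (I.prod 𝓘(ℝ, ℂ)) 𝓘(ℝ, ℝ) ∞ h (univ ×ˢ Metric.ball (0 : ℂ) 1))
    {η : Distribution (I.prod 𝓘(ℝ, ℂ)) (F × disk)}
    (hη : IsContactStructure η)
    (hker : ∀ (x : F × disk) (v : TangentSpace (I.prod 𝓘(ℝ, ℂ)) x),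
      v ∈ η x ↔ radialForm α h x v = 0) (p₀ : F) :
    ∃ G : E × ℂ → ℝ, ContDiff ℝ ∞ G ∧ G (extChartAt I p₀ p₀, 0) ≠ 0 ∧
      ∀ᶠ y in 𝓝 (extChartAt I p₀ p₀, (0 : ℂ)),
        h ((extChartAt I p₀).symm y.1, y.2) = Complex.normSq y.2 * G y := by
  let x₀ : F × disk := (p₀, ⟨0, by simp [disk]⟩)
  obtain ⟨U, hU, hxU, β, hβ, hβη⟩ := hη x₀
  set φ := extChartAt (I.prod 𝓘(ℝ, ℂ)) x₀ with hφ
  set y₀ : E := extChartAt I p₀ p₀ with hy₀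
  have hφx : φ x₀ = (y₀, 0) := by
    rw [hφ, extChartAt_prod]; rfl
  set T : Set (E × ℂ) := φ.target ∩ φ.symm ⁻¹' U with hT
  have hTopen : IsOpen T :=
    (continuousOn_extChartAt_symm x₀).isOpen_inter_preimage (isOpen_extChartAt_target x₀) hU
  have hTy : (y₀, (0 : ℂ)) ∈ T := by
    rw [← hφx]
    refine ⟨mem_extChartAt_target x₀, ?_⟩
    rw [mem_preimage, hφ, extChartAt_to_inv]
    exact hxU
  have hT1 : ∀ y ∈ T, y.1 ∈ (extChartAt I p₀).target := by
    intro y hy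
    have := hy.1
    rw [hφ, extChartAt_prod] at this
    exact this.1
  have hT2 : ∀ y ∈ T, y.2 ∈ Metric.ball (0 : ℂ) 1 := by
    intro y hy
    have := hy.1
    rw [hφ, extChartAt_prod] at this
    rw [← coe_extChartAt_disk_symm x₀.2 this.2]
    exact ((extChartAt 𝓘(ℝ, ℂ) x₀.2).symm y.2).2
  set b : E × ℂ → E × ℂ →L[ℝ] ℝ := β.inChart x₀ with hb
  set c : E × ℂ → E × ℂ →L[ℝ] ℝ := (radialForm α h).inChart x₀ with hc
  set a : E → E →L[ℝ] ℝ := α.inChart p₀ with ha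
  set k : E × ℂ → ℝ := fun y => h ((extChartAt I p₀).symm y.1, y.2) with hk
  have hcy : ∀ y ∈ T, ∀ v, c y v = a y.1 v.1 + k y * dTheta y.2 v.2 := fun y hy v =>
    radialForm_inChart α h x₀ hy.1 v
  have hbc : ∀ y ∈ T, ∀ v, b y v = 0 ↔ c y v = 0 := fun y hy v =>
    (hβη (φ.symm y) hy.2 _).symm.trans (hker (φ.symm y) _)
  have hbs : ContDiffOn ℝ ∞ b T := hβ.smoothOn x₀
  have has : ContDiffOn ℝ ∞ a (extChartAt I p₀).target := by
    simpa using hα.smoothOn p₀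
  have hks : ContinuousOn k T := by
    refine hh.continuousOn.comp (f := fun y : E × ℂ => ((extChartAt I p₀).symm y.1, y.2))
      (ContinuousOn.prodMk ?_ continuousOn_snd) fun y hy => ⟨mem_univ _, hT2 y hy⟩
    exact (continuousOn_extChartAt_symm p₀).comp continuousOn_fst hT1
  obtain ⟨e, he⟩ : ∃ e : E, a y₀ e ≠ 0 := by
    by_contra! h0
    refine hα.ne_zero p₀ (mem_univ _) ?_
    ext v
    exact (OneForm.inChart_self α p₀ v).symm.trans (h0 v)
  have has1 : ContDiffOn ℝ ∞ (fun y : E × ℂ => a y.1 e) T :=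
    (has.comp contDiffOn_fst hT1).clm_apply contDiffOn_const
  set T' : Set (E × ℂ) := {y ∈ T | a y.1 e ≠ 0} with hT'
  have hT'n : T' ∈ 𝓝 (y₀, (0 : ℂ)) := by
    have h1 : ContinuousAt (fun y : E × ℂ => a y.1 e) (y₀, 0) :=
      has1.continuousOn.continuousAt (hTopen.mem_nhds hTy)
    exact Filter.inter_mem (hTopen.mem_nhds hTy) (h1.eventually_ne he)
  have hce : ∀ y ∈ T', c y (e, 0) = a y.1 e := by
    intro y hy
    simp [hcy y hy.1]
  have hbe : ∀ y ∈ T', b y (e, 0) ≠ 0 := by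
    intro y hy h0
    exact hy.2 ((hce y hy).symm.trans ((hbc y hy.1 _).1 h0))
  -- Equal kernels make the contact form a multiple of `α + h dθ`; testing on `(e, 0)`, where `dθ`
  -- contributes nothing, identifies the factor as a smooth function.
  have hprop : ∀ y ∈ T', ∀ v, b y v = b y (e, 0) / a y.1 e * c y v := by
    intro y hy v
    have h1 := apply_mul_eq_of_ker_eq (hbc y hy.1) (e, 0) v
    rw [hce y hy] at h1
    field_simp [hy.2]
    linarith
  -- The function divided here is `h dθ(∂_y) = h x / r²`. It is smooth because it is expressed
  -- through the contact form, and it vanishes for `x = 0`, so Hadamard's lemma removes the factor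
  -- `x` and leaves `h / r²`.
  obtain ⟨G, hG, hGeq⟩ := exists_contDiff_eq_mul
    (Complex.reCLM.comp (ContinuousLinearMap.snd ℝ E ℂ)) (e := (0, 1)) (by simp) hT'n
    (A := fun y => b y (0, Complex.I) * a y.1 e / b y (e, 0))
    (by
      refine ContDiffOn.div (ContDiffOn.mul ?_ (has1.mono fun y hy => hy.1)) ?_ hbe
      · exact (hbs.mono fun y hy => hy.1).clm_apply contDiffOn_const
      · exact (hbs.mono fun y hy => hy.1).clm_apply contDiffOn_const)
    (by
      intro y hy hy0
      have hre : y.2.re = 0 := hy0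
      have hc0 : c y (0, Complex.I) = 0 := by
        simp [hcy y hy.1, dTheta_apply, areaForm, hre]
      simp [(hbc y hy.1 _).2 hc0])
  have hmul : ∀ᶠ y in 𝓝 (y₀, (0 : ℂ)), k y * dTheta y.2 Complex.I = y.2.re * G y := by
    filter_upwards [hGeq, hT'n] with y h1 h2
    have h3 : y.2.re * G y = b y (0, Complex.I) * a y.1 e / b y (e, 0) := h1.symm
    have h4 : c y (0, Complex.I) = k y * dTheta y.2 Complex.I := by simp [hcy y h2.1]
    rw [h3, ← h4, hprop y h2]
    have := hbe y h2
    have := h2.2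
    field_simp
  have hkG : ∀ᶠ y in 𝓝 (y₀, (0 : ℂ)), k y = Complex.normSq y.2 * G y := by
    have hne : ∀ᶠ y in 𝓝 (y₀, (0 : ℂ)), y.2.re ≠ 0 → k y = Complex.normSq y.2 * G y := by
      filter_upwards [hmul] with y h1 hre
      have hz : Complex.normSq y.2 ≠ 0 := by
        rw [Ne, Complex.normSq_eq_zero]
        intro h0
        simp [h0] at hre
      rw [dTheta_apply] at h1
      simp only [areaForm, Complex.I_im, Complex.I_re, mul_one, mul_zero, sub_zero] at h1
      field_simp at h1
      linarith
    filter_upwards [hne.eventually_nhds, hTopen.mem_nhds hTy] with y h1 h2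
    have hcont : ContinuousAt (fun y => k y - Complex.normSq y.2 * G y) y :=
      (hks.continuousAt (hTopen.mem_nhds h2)).sub
        ((Complex.continuous_normSq.comp continuous_snd).mul hG.continuous).continuousAt
    by_cases hre : y.2.re = 0
    swap
    · exact h1.self_of_nhds hre
    -- The identity is known off `x = 0`; points with `x = 0` are approached along the real
    -- direction.
    have hline : Tendsto (fun s : ℝ => y + (0, (s : ℂ))) (𝓝[≠] 0) (𝓝 y) := by
      have : Continuous fun s : ℝ => y + ((0 : E), (s : ℂ)) := by fun_prop
      have h3 := this.tendsto 0
      simp only [Complex.ofReal_zero, Prod.mk_zero_zero, add_zero] at h3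
      exact h3.mono_left nhdsWithin_le_nhds
    have hlim := hcont.tendsto.comp hline
    have hlim0 : Tendsto ((fun y => k y - Complex.normSq y.2 * G y) ∘
        fun s : ℝ => y + (0, (s : ℂ))) (𝓝[≠] 0) (𝓝 0) := by
      refine tendsto_const_nhds.congr' ?_
      filter_upwards [hline.eventually h1, self_mem_nhdsWithin] with s hs hs0
      have : (y + (0, (s : ℂ))).2.re ≠ 0 := by simpa [hre] using hs0
      exact (sub_eq_zero.2 (hs this)).symm
    exact sub_eq_zero.1 (tendsto_nhds_unique hlim hlim0)
  refine ⟨G, hG, ?_, hkG⟩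
  intro hG0
  have hTn := hTopen.mem_nhds hTy
  have has0 : ContDiffAt ℝ ∞ a y₀ := has.contDiffAt (extChartAt_target_mem_nhds p₀)
  have hμ : DifferentiableAt ℝ (fun y => b y (e, 0) / a y.1 e) (y₀, 0) := by
    have h1 : ContDiffAt ℝ ∞ (fun y => b y (e, 0)) (y₀, 0) :=
      (hbs.contDiffAt hTn).clm_apply contDiffAt_const
    exact (h1.div (has1.contDiffAt hTn) he).differentiableAt (by simp)
  -- If `G` vanished at the origin, the vector `∂_x` would lie in the kernel of the contact form and
  -- be `dβ`-orthogonal to it, contradicting nondegeneracy.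
  have hd := exteriorDeriv_eq_zero_of_weight_eq_zero (b := b) (a := a)
    ((hbs.contDiffAt hTn).differentiableAt (by simp)) (has0.differentiableAt (by simp)) hμ
    (hG.contDiffAt.differentiableAt (by simp)) hG0 (by
      filter_upwards [hkG, hT'n] with y h1 h2 v
      rw [hprop y h2, hcy y h2.1, h1, mul_comm (Complex.normSq y.2), mul_assoc,
        normSq_mul_dTheta])
  have hβ0 : ∀ v : E × ℂ, β x₀ v = 0 ↔ a y₀ v.1 = 0 := by
    intro v
    have h1 : b (y₀, 0) v = β x₀ v := by
      rw [hb, ← hφx]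
      exact OneForm.inChart_self β x₀ v
    rw [← h1, hbc _ hTy, hcy _ hTy]
    simp [dTheta]
  have hu : ((0, 1) : E × ℂ) = 0 := hβ.nondegenerate x₀ hxU ((0, 1) : E × ℂ)
    ((hβ0 (0, 1)).2 (by simp)) fun v hv => by
      have h1 := hd v ((hβ0 v).1 hv)
      rw [← hφx] at h1
      exact h1
  exact one_ne_zero (congrArg Prod.snd hu)

end Weight

/-! ### From a radial contact fibration to a profile. -/

section Extraction

variable {E : Type} [NormedAddCommGroup E] [NormedSpace ℝ E] [FiniteDimensional ℝ E]
  {H : Type*} [TopologicalSpace H] {I : ModelWithCorners ℝ E H} [I.Boundaryless]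
  {F : Type*} [TopologicalSpace F] [ChartedSpace H F] [IsManifold I ∞ F]

/-- The weight `h / r²`, extended to the origin of the disk by its limit. -/
def weight (h : F × ℂ → ℝ) (q : F × ℂ) : ℝ :=
  if q.2 = 0 then limUnder (𝓝[≠] (0 : ℂ)) fun z => h (q.1, z) / Complex.normSq z
  else h q / Complex.normSq q.2

omit [TopologicalSpace F] in
theorem normSq_mul_weight {h : F × ℂ → ℝ} {q : F × ℂ} (hq : q.2 ≠ 0) :
    Complex.normSq q.2 * weight h q = h q := by
  rw [weight, if_neg hq, mul_div_cancel₀]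
  simpa using hq

omit [FiniteDimensional ℝ E] [I.Boundaryless] [IsManifold I ∞ F] in
-- Off the origin this is the hypothesis divided by `r²`. Over the origin, at every nearby point of
-- `F`, continuity of `G` shows that the limit defining `weight` exists and equals `G`.
theorem weight_eventuallyEq {h : F × ℂ → ℝ} {p₀ : F} {G : E × ℂ → ℝ} (hG : Continuous G)
    (hhG : ∀ᶠ y in 𝓝 (extChartAt I p₀ p₀, (0 : ℂ)),
      h ((extChartAt I p₀).symm y.1, y.2) = Complex.normSq y.2 * G y) :
    weight h =ᶠ[𝓝 (p₀, 0)] fun q => G (extChartAt I p₀ q.1, q.2) := by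
  have hc : ContinuousAt (fun q : F × ℂ => (extChartAt I p₀ q.1, q.2)) (p₀, 0) :=
    (ContinuousAt.comp (f := Prod.fst) (continuousAt_extChartAt (I := I) p₀)
      continuousAt_fst).prodMk continuousAt_snd
  have hsrc : ∀ᶠ q : F × ℂ in 𝓝 (p₀, 0), q.1 ∈ (extChartAt I p₀).source :=
    continuousAt_fst.eventually (extChartAt_source_mem_nhds p₀)
  have hq : ∀ᶠ q : F × ℂ in 𝓝 (p₀, 0), q.2 ≠ 0 → h q / Complex.normSq q.2 =
      G (extChartAt I p₀ q.1, q.2) := by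
    filter_upwards [hsrc, hc.eventually hhG] with q h1 h2 h3
    have hne : Complex.normSq q.2 ≠ 0 := by simpa using h3
    simp only [(extChartAt I p₀).left_inv h1] at h2
    rw [div_eq_iff hne, mul_comm]
    exact h2
  filter_upwards [hq.eventually_nhds] with q h1
  by_cases h0 : q.2 = 0
  · rw [weight, if_pos h0]
    refine Tendsto.limUnder_eq ?_
    have hline : Tendsto (fun z : ℂ => (q.1, z)) (𝓝[≠] 0) (𝓝 q) := by
      have : Continuous fun z : ℂ => (q.1, z) := by fun_prop
      have h2 := this.tendsto 0
      rw [← h0] at h2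
      rw [← h0]
      exact h2.mono_left nhdsWithin_le_nhds
    have hlim : Tendsto (fun z : ℂ => G (extChartAt I p₀ q.1, z)) (𝓝[≠] 0)
        (𝓝 (G (extChartAt I p₀ q.1, q.2))) := by
      have : Continuous fun z : ℂ => G (extChartAt I p₀ q.1, z) := by fun_prop
      rw [h0]
      exact (this.tendsto 0).mono_left nhdsWithin_le_nhds
    refine hlim.congr' ?_
    filter_upwards [hline.eventually h1, self_mem_nhdsWithin] with z hz hz0
    exact (hz hz0).symm
  · rw [weight, if_neg h0]
    exact h1.self_of_nhds h0

/-- A radial contact fibration is the kernel of `α + g (x dy - y dx)` for a smooth positive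
function `g` such that `r² g` is strictly increasing along rays. -/
theorem IsRadialContactFibration.exists_profile {α : OneForm I F} (hα : α.IsContactOn univ)
    {η : Distribution (I.prod 𝓘(ℝ, ℂ)) (F × disk)} (hη : IsRadialContactFibration α η) :
    ∃ g : F × ℂ → ℝ, IsProfile I g ∧
      ∀ (x : F × disk) (v : TangentSpace (I.prod 𝓘(ℝ, ℂ)) x),
        v ∈ η x ↔ α x.1 v.1 + g (x.1, (x.2 : ℂ)) * areaForm (x.2 : ℂ) v.2 = 0 := by
  obtain ⟨h, hh, -, hder, hker⟩ := hη.radial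
  have hloc := exists_contDiff_weight hα hh hη.contact hker
  have hh0 : ∀ p, h (p, 0) = 0 := by
    intro p
    obtain ⟨G, -, -, hGh⟩ := hloc p
    simpa using hGh.self_of_nhds
  have hball : IsOpen (univ ×ˢ Metric.ball (0 : ℂ) 1 : Set (F × ℂ)) :=
    isOpen_univ.prod Metric.isOpen_ball
  have hsmooth : ContMDiffOn (I.prod 𝓘(ℝ, ℂ)) 𝓘(ℝ, ℝ) ∞ (weight h)
      (univ ×ˢ Metric.ball 0 1) := by
    rintro ⟨p, z⟩ hz
    refine ContMDiffAt.contMDiffWithinAt ?_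
    by_cases hz0 : z = 0
    · subst hz0
      obtain ⟨G, hG, -, hGh⟩ := hloc p
      refine ContMDiffAt.congr_of_eventuallyEq ?_ (weight_eventuallyEq hG.continuous hGh)
      have h1 : ContMDiffAt (I.prod 𝓘(ℝ, ℂ)) 𝓘(ℝ, E × ℂ) ∞
          (fun q : F × ℂ => (extChartAt I p q.1, q.2)) (p, 0) :=
        (contMDiffAt_extChartAt.comp (p, (0 : ℂ)) contMDiffAt_fst).prodMk_space contMDiffAt_snd
      exact hG.contDiffAt.contMDiffAt.comp (p, (0 : ℂ)) h1
    · have h1 : ContMDiffAt (I.prod 𝓘(ℝ, ℂ)) 𝓘(ℝ, ℝ) ∞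
          (fun q : F × ℂ => h q * (Complex.normSq q.2)⁻¹) (p, z) := by
        refine (hh.contMDiffAt (hball.mem_nhds hz)).mul ?_
        have h2 : ContDiffAt ℝ ∞ (fun z : ℂ => (Complex.normSq z)⁻¹) z := by
          refine ContDiffAt.inv ?_ (by simpa using hz0)
          rw [show (Complex.normSq : ℂ → ℝ) = fun z => z.re * z.re + z.im * z.im from
            funext Complex.normSq_apply]
          exact (((Complex.reCLM.contDiff.mul Complex.reCLM.contDiff).add
            (Complex.imCLM.contDiff.mul Complex.imCLM.contDiff)).contDiffAt)
        exact ContMDiffAt.comp (g := fun z : ℂ => (Complex.normSq z)⁻¹) (f := Prod.snd) (p, z)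
          h2.contMDiffAt contMDiffAt_snd
      refine h1.congr_of_eventuallyEq ?_
      have h3 : ∀ᶠ q : F × ℂ in 𝓝 (p, z), q.2 ≠ 0 := continuousAt_snd.eventually_ne hz0
      filter_upwards [h3] with q hq
      rw [weight, if_neg hq, div_eq_mul_inv]
  have hsm : ∀ p, ContDiffOn ℝ ∞ (fun z => weight h (p, z)) (Metric.ball 0 1) := by
    intro p
    rw [← contMDiffOn_iff_contDiffOn]
    exact hsmooth.comp (f := fun z : ℂ => (p, z))
      (contMDiff_const.prodMk contMDiff_id).contMDiffOn fun z hz => ⟨mem_univ _, hz⟩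
  have hmem : ∀ (θ r : ℝ), r ∈ Ico (0 : ℝ) 1 →
      (r : ℂ) * Complex.exp (θ * Complex.I) ∈ Metric.ball (0 : ℂ) 1 := by
    intro θ r hr
    simpa [abs_of_nonneg hr.1, Complex.norm_exp_ofReal_mul_I] using hr.2
  have hcont : ∀ (p : F) (θ : ℝ),
      ContinuousOn (fun s : ℝ => h (p, (s : ℂ) * Complex.exp (θ * Complex.I))) (Ico 0 1) := by
    intro p θ
    refine hh.continuousOn.comp
      (f := fun s : ℝ => (p, (s : ℂ) * Complex.exp (θ * Complex.I))) (by fun_prop) ?_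
    exact fun s hs => ⟨mem_univ _, hmem θ s hs⟩
  have hhpos : ∀ (p : F) (z : ℂ), z ∈ Metric.ball (0 : ℂ) 1 → z ≠ 0 → 0 < h (p, z) := by
    intro p z hz hz0
    have hmono := strictMonoOn_of_deriv_pos (convex_Ico 0 1) (hcont p z.arg) (fun r hr => by
      rw [interior_Ico] at hr
      exact hder p z.arg r hr.1 hr.2)
    have := hmono (left_mem_Ico.2 one_pos) ⟨norm_nonneg z, mem_ball_zero_iff.1 hz⟩
      (norm_pos_iff.2 hz0)
    simpa [hh0, Complex.norm_mul_exp_arg_mul_I] using this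
  have hpos : ∀ (p : F) (z : ℂ), z ∈ Metric.ball (0 : ℂ) 1 → 0 < weight h (p, z) := by
    intro p z hz
    by_cases hz0 : z = 0
    · subst hz0
      obtain ⟨G, hG, hG0, hGh⟩ := hloc p
      have h1 : weight h (p, 0) ≠ 0 := by
        rw [(weight_eventuallyEq hG.continuous hGh).self_of_nhds]
        exact hG0
      -- At the origin the weight is nonnegative as a limit of positive values; the contact
      -- condition excludes zero.
      refine lt_of_le_of_ne ?_ h1.symm
      have h2 : ContinuousAt (fun z => weight h (p, z)) 0 :=
        (hsm p).continuousOn.continuousAt (Metric.isOpen_ball.mem_nhds hz)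
      refine ge_of_tendsto (h2.tendsto.mono_left (nhdsWithin_le_nhds (s := {0}ᶜ))) ?_
      filter_upwards [self_mem_nhdsWithin,
        nhdsWithin_le_nhds (Metric.isOpen_ball.mem_nhds hz)] with w hw hw1
      rw [weight, if_neg (show w ≠ 0 from hw)]
      exact div_nonneg (hhpos p w hw1 hw).le (Complex.normSq_nonneg w)
    · rw [weight, if_neg hz0]
      exact div_pos (hhpos p z hz hz0) (Complex.normSq_pos.2 hz0)
  refine ⟨weight h, ⟨hsmooth, fun p => ⟨hsm p, hpos p, ?_⟩⟩, ?_⟩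
  · intro z hz
    by_cases hz0 : z = 0
    · subst hz0
      simpa using hpos p 0 hz
    have hr : 0 < ‖z‖ := norm_pos_iff.2 hz0
    have hd := hder p z.arg ‖z‖ hr (mem_ball_zero_iff.1 hz)
    set e : ℂ := Complex.exp (z.arg * Complex.I) with he
    have hze : (‖z‖ : ℂ) * e = z := Complex.norm_mul_exp_arg_mul_I z
    have he1 : Complex.normSq e = 1 := by
      rw [Complex.normSq_eq_norm_sq, he, Complex.norm_exp_ofReal_mul_I, one_pow]
    -- Differentiating `h = s² g` along the ray gives `∂h/∂r = r (2g + dg(z) z)`, so the hypothesis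
    -- on `∂h/∂r` is exactly the radial condition on `g`.
    have heq : (fun s : ℝ => h (p, (s : ℂ) * e)) =ᶠ[𝓝 ‖z‖]
        fun s => s ^ 2 * weight h (p, (s : ℂ) * e) := by
      filter_upwards [eventually_gt_nhds hr] with s hs
      have hne : ((p, (s : ℂ) * e) : F × ℂ).2 ≠ 0 :=
        mul_ne_zero (by exact_mod_cast hs.ne') (Complex.exp_ne_zero _)
      rw [← normSq_mul_weight (h := h) hne, Complex.normSq_mul, he1, Complex.normSq_ofReal]
      ring
    have hga : DifferentiableAt ℝ (fun z => weight h (p, z)) ((‖z‖ : ℂ) * e) := by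
      rw [hze]
      exact ((hsm p).contDiffAt (Metric.isOpen_ball.mem_nhds hz)).differentiableAt (by simp)
    have hline : HasDerivAt (fun s : ℝ => (s : ℂ) * e) e ‖z‖ := by
      simpa using (Complex.ofRealCLM.hasDerivAt (x := ‖z‖)).mul_const e
    have h1 := (hasDerivAt_pow 2 ‖z‖).mul (hga.hasFDerivAt.comp_hasDerivAt ‖z‖ hline)
    have h2 : HasDerivAt (fun s : ℝ => s ^ 2 * weight h (p, (s : ℂ) * e)) _ ‖z‖ := h1
    rw [heq.deriv_eq, h2.deriv] at hd
    simp only [Function.comp_apply, hze] at hd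
    have h3 : fderiv ℝ (fun z => weight h (p, z)) z z =
        ‖z‖ * fderiv ℝ (fun z => weight h (p, z)) z e := by
      conv_lhs => rw [show fderiv ℝ (fun z => weight h (p, z)) z z =
        fderiv ℝ (fun z => weight h (p, z)) z (‖z‖ • e) by
          rw [Complex.real_smul, hze]]
      rw [map_smul, smul_eq_mul]
    rw [h3]
    have h4 : 0 < ‖z‖ * (2 * weight h (p, z) +
        ‖z‖ * fderiv ℝ (fun z => weight h (p, z)) z e) := by
      convert! hd using 1
      simp
      ring
    exact pos_of_mul_pos_right h4 hr.le
  · intro x v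
    rw [hker, radialForm_apply]
    by_cases hz : (x.2 : ℂ) = 0
    · simp [hz, dTheta, areaForm]
    · have h1 : h (x.1, (x.2 : ℂ)) = Complex.normSq (x.2 : ℂ) * weight h (x.1, (x.2 : ℂ)) :=
        (normSq_mul_weight (q := (x.1, (x.2 : ℂ))) hz).symm
      rw [h1, mul_comm (Complex.normSq _), mul_assoc, normSq_mul_dTheta]

end Extraction

/-! ### Diffeomorphisms acting on distributions. -/

section CarriesLemmas

variable {E : Type*} [NormedAddCommGroup E] [NormedSpace ℝ E]
  {H : Type*} [TopologicalSpace H] {I : ModelWithCorners ℝ E H}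
  {E' : Type*} [NormedAddCommGroup E'] [NormedSpace ℝ E']
  {H' : Type*} [TopologicalSpace H'] {I' : ModelWithCorners ℝ E' H'}
  {E'' : Type*} [NormedAddCommGroup E''] [NormedSpace ℝ E'']
  {H'' : Type*} [TopologicalSpace H''] {I'' : ModelWithCorners ℝ E'' H''}
  {M : Type*} [TopologicalSpace M] [ChartedSpace H M]
  {N : Type*} [TopologicalSpace N] [ChartedSpace H' N]
  {Q : Type*} [TopologicalSpace Q] [ChartedSpace H'' Q]

theorem mfderiv_diffeomorph_symm_apply (φ : M ≃ₘ⟮I, I'⟯ N) (x : M) (v : E) :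
    mfderiv I' I φ.symm (φ x) (mfderiv I I' φ x v) = v := by
  have h1 : MDifferentiableAt I I' φ x := φ.mdifferentiable (by simp) x
  have h2 : MDifferentiableAt I' I φ.symm (φ x) := φ.symm.mdifferentiable (by simp) _
  have h3 := h2.hasMFDerivAt.comp x h1.hasMFDerivAt
  have h4 : φ.symm ∘ φ = id := funext φ.symm_apply_apply
  rw [h4] at h3
  exact congrArg (fun T : E →L[ℝ] E => T v) (hasMFDerivAt_unique h3 (hasMFDerivAt_id x))

theorem mfderiv_diffeomorph_apply_symm (φ : M ≃ₘ⟮I, I'⟯ N) (x : M) (w : E') :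
    mfderiv I I' φ x (mfderiv I' I φ.symm (φ x) w) = w := by
  have h1 : MDifferentiableAt I I' φ (φ.symm (φ x)) := φ.mdifferentiable (by simp) _
  have h2 : MDifferentiableAt I' I φ.symm (φ x) := φ.symm.mdifferentiable (by simp) _
  have h3 := h1.hasMFDerivAt.comp (φ x) h2.hasMFDerivAt
  have h4 : φ ∘ φ.symm = id := funext φ.apply_symm_apply
  rw [h4] at h3
  have h5 := congrArg (fun T : E' →L[ℝ] E' => T w)
    (hasMFDerivAt_unique h3 (hasMFDerivAt_id (φ x)))
  have h6 : ∀ y, y = x → (mfderiv I I' φ y : E →L[ℝ] E') = mfderiv I I' φ x := by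
    rintro _ rfl
    rfl
  have h7 := congrArg (fun T : E →L[ℝ] E' => T (mfderiv I' I φ.symm (φ x) w))
    (h6 _ (φ.symm_apply_apply x))
  exact h7.symm.trans h5

/-- The differential of a diffeomorphism is bijective, so equality of images reduces to a membership
test on vectors, which composes and inverts easily. -/
theorem carries_diffeomorph_iff (φ : M ≃ₘ⟮I, I'⟯ N) {ξ : Distribution I M}
    {η : Distribution I' N} :
    Carries φ ξ η ↔
      ∀ (x : M) (v : TangentSpace I x), v ∈ ξ x ↔ mfderiv I I' φ x v ∈ η (φ x) := by
  constructor
  · intro h x v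
    rw [← h x]
    constructor
    · exact fun hv => ⟨v, hv, rfl⟩
    · rintro ⟨w, hw, hwv⟩
      have h1 : mfderiv I I' φ x w = mfderiv I I' φ x v := hwv
      have h2 := congrArg (mfderiv I' I φ.symm (φ x)) h1
      have h3 : w = v := (mfderiv_diffeomorph_symm_apply φ x w).symm.trans
        (h2.trans (mfderiv_diffeomorph_symm_apply φ x v))
      exact h3 ▸ hw
  · intro h x
    ext w
    constructor
    · rintro ⟨v, hv, rfl⟩
      exact (h x v).1 hv
    · intro hw
      refine ⟨mfderiv I' I φ.symm (φ x) w, (h x _).2 ?_, mfderiv_diffeomorph_apply_symm φ x w⟩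
      have h1 : mfderiv I I' φ x (mfderiv I' I φ.symm (φ x) w) = w :=
        mfderiv_diffeomorph_apply_symm φ x w
      rw [h1]
      exact hw

theorem Carries.trans {φ : M ≃ₘ⟮I, I'⟯ N} {ψ : N ≃ₘ⟮I', I''⟯ Q} {ξ : Distribution I M}
    {η : Distribution I' N} {ζ : Distribution I'' Q} (hφ : Carries φ ξ η) (hψ : Carries ψ η ζ) :
    Carries (φ.trans ψ) ξ ζ := by
  rw [carries_diffeomorph_iff] at hφ hψ ⊢
  intro x v
  rw [hφ, hψ]
  have h1 : MDifferentiableAt I I' φ x := φ.mdifferentiable (by simp) x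
  have h2 : MDifferentiableAt I' I'' ψ (φ x) := ψ.mdifferentiable (by simp) _
  have h3 : mfderiv I I'' (φ.trans ψ) x v = mfderiv I' I'' ψ (φ x) (mfderiv I I' φ x v) :=
    congrArg (fun T : E →L[ℝ] E'' => T v) (h2.hasMFDerivAt.comp x h1.hasMFDerivAt).mfderiv
  rw [h3]
  rfl

theorem mem_distribution_congr (η : Distribution I M) {x y : M} (h : x = y) (v : E) :
    v ∈ (η x : Submodule ℝ E) ↔ v ∈ (η y : Submodule ℝ E) := by
  subst h
  rfl

theorem Carries.symm {φ : M ≃ₘ⟮I, I'⟯ N} {ξ : Distribution I M} {η : Distribution I' N}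
    (h : Carries φ ξ η) : Carries φ.symm η ξ := by
  rw [carries_diffeomorph_iff] at h ⊢
  intro y w
  obtain ⟨x, rfl⟩ := φ.surjective y
  have h1 := h x (mfderiv I' I φ.symm (φ x) w)
  have h2 : mfderiv I I' φ x (mfderiv I' I φ.symm (φ x) w) = w :=
    mfderiv_diffeomorph_apply_symm φ x w
  rw [h2] at h1
  refine h1.symm.trans ?_
  exact mem_distribution_congr ξ (φ.symm_apply_apply x).symm _

/-- If two diffeomorphisms coincide near a point and carry the same plane at this point to two
distributions, then these coincide at the image. -/
theorem Carries.eq_of_eventuallyEq {φ ψ : M ≃ₘ⟮I, I'⟯ N} {ξ₀ ξ₁ : Distribution I M}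
    {η₀ η₁ : Distribution I' N} (h₀ : Carries φ ξ₀ η₀) (h₁ : Carries ψ ξ₁ η₁) {x : M}
    (hξ : ξ₀ x = ξ₁ x) (h : ψ =ᶠ[𝓝 x] φ) : η₀ (φ x) = η₁ (φ x) := by
  rw [carries_diffeomorph_iff] at h₀ h₁
  ext w
  have h2 : mfderiv I I' φ x (mfderiv I' I φ.symm (φ x) w) = w :=
    mfderiv_diffeomorph_apply_symm φ x w
  have h3 : mfderiv I I' ψ x (mfderiv I' I φ.symm (φ x) w) = w :=
    (congrArg (fun T : E →L[ℝ] E' => T (mfderiv I' I φ.symm (φ x) w)) h.mfderiv_eq).trans h2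
  have h4 := h₀ x (mfderiv I' I φ.symm (φ x) w)
  have h5 := h₁ x (mfderiv I' I φ.symm (φ x) w)
  rw [h2] at h4
  rw [h3] at h5
  rw [← h4, hξ]
  refine h5.trans ?_
  exact mem_distribution_congr η₁ h.self_of_nhds w

end CarriesLemmas

/-! ### Neighbourhoods of the boundary. -/

section NearBoundary

variable {F : Type*} [TopologicalSpace F]

/-- Traces of open sets are open. This turns pointwise coincidence of maps near the boundary into
coincidence of germs, so that differentials can be compared. -/
theorem eventually_eventually_nearBoundary {p : F × disk → Prop}
    (h : ∀ᶠ x in nearBoundary F, p x) : ∀ᶠ x in nearBoundary F, ∀ᶠ y in 𝓝 x, p y := by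
  obtain ⟨s, hs, hsp⟩ := mem_comap.1 h
  obtain ⟨O, hO, hOb, hOs⟩ := mem_nhdsSet_iff_exists.1 hs
  refine mem_comap.2 ⟨O, hO.mem_nhdsSet.2 hOb, fun x hx => ?_⟩
  have hc : Continuous fun x : F × disk => (x.1, (x.2 : ℂ)) := by fun_prop
  filter_upwards [(hO.preimage hc).mem_nhds hx] with y hy
  exact hsp (hOs hy)

theorem eventually_slice_of_nearBoundary {p : F × ℂ → Prop}
    (h : ∀ᶠ x in nearBoundary F, p (x.1, (x.2 : ℂ))) (q : F) {e : ℂ} (he : ‖e‖ = 1) :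
    ∀ᶠ z in 𝓝 e, ‖z‖ < 1 → p (q, z) := by
  have h1 := eventually_comap.1 h
  have h2 : ∀ᶠ y in 𝓝 (q, e), ∀ x : F × disk, (x.1, (x.2 : ℂ)) = y → p (x.1, (x.2 : ℂ)) :=
    h1.filter_mono (nhds_le_nhdsSet (s := univ ×ˢ Metric.sphere (0 : ℂ) 1)
      ⟨mem_univ _, by simpa using he⟩)
  have h3 : ContinuousAt (fun z : ℂ => (q, z)) e := by fun_prop
  filter_upwards [h3.eventually h2] with z hz hz1
  exact hz (q, ⟨z, mem_ball_zero_iff.2 hz1⟩) rfl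

theorem eventually_nearBoundary_ne_zero :
    ∀ᶠ x in nearBoundary F, (x.2 : ℂ) ≠ 0 := by
  have hO : IsOpen {y : F × ℂ | y.2 ≠ 0} := isOpen_ne_fun continuous_snd continuous_const
  refine mem_comap.2 ⟨_, hO.mem_nhdsSet.2 ?_, fun x hx => hx⟩
  rintro y ⟨-, hy⟩ h0
  simp [h0] at hy

end NearBoundary

/-! ### Identities for the area form. -/

section AreaForm

theorem areaForm_smul_add (s c : ℝ) (z w : ℂ) :
    areaForm (s • z) (s • w + c • z) = s ^ 2 * areaForm z w := by
  simp [areaForm]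
  ring

theorem areaForm_mul_I (z : ℂ) : areaForm z (Complex.I * z) = Complex.normSq z := by
  simp [areaForm, Complex.normSq_apply]

theorem areaForm_circle_mul (ζ : Circle) (z w : ℂ) :
    areaForm ((ζ : ℂ) * z) ((ζ : ℂ) * w) = areaForm z w := by
  have h := Circle.normSq_coe ζ
  rw [Complex.normSq_apply] at h
  simp only [areaForm, Complex.mul_re, Complex.mul_im]
  linear_combination (z.re * w.im - z.im * w.re) * h

end AreaForm

/-! ### Pullbacks of kernels and symmetries of the model. -/

section Model

variable {E : Type} [NormedAddCommGroup E] [NormedSpace ℝ E]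
  {H : Type*} [TopologicalSpace H] {I : ModelWithCorners ℝ E H}
  {F : Type*} [TopologicalSpace F] [ChartedSpace H F]

/-- The spreading map pulls back `x dy - y dx` to `g (x dy - y dx)`. -/
theorem IsProfile.areaForm_mfderiv_spread {g : F × ℂ → ℝ} (hg : IsProfile I g) (x : F × disk)
    (v : E × ℂ) :
    areaForm (spread (fun z => g (x.1, z)) x.2)
      (mfderiv (I.prod 𝓘(ℝ, ℂ)) 𝓘(ℝ, ℂ)
        (fun q : F × disk => spread (fun z => g (q.1, z)) q.2) x v) =
      g (x.1, (x.2 : ℂ)) * areaForm x.2 v.2 := by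
  have hS := ((hg.contMDiff_sqrt x).mdifferentiableAt (by simp)).hasMFDerivAt
  have hz := (hasMFDerivAt_disk_coe x.2).comp x
    (hasMFDerivAt_snd (I := I) (I' := 𝓘(ℝ, ℂ)) (x := x))
  set D : E × ℂ →L[ℝ] ℝ :=
    mfderiv (I.prod 𝓘(ℝ, ℂ)) 𝓘(ℝ, ℝ) (fun q : F × disk => √(g (q.1, q.2))) x with hD
  have hSz : HasMFDerivAt (I.prod 𝓘(ℝ, ℂ)) 𝓘(ℝ, ℝ × ℂ)
      (fun q : F × disk => (√(g (q.1, q.2)), (q.2 : ℂ))) x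
      (D.prod (ContinuousLinearMap.snd ℝ E ℂ)) :=
    ⟨hS.1.prodMk hz.1, hS.2.prodMk hz.2⟩
  have hm := (hasFDerivAt_fst (𝕜 := ℝ) (E := ℝ) (F := ℂ) (p := (√(g (x.1, x.2)), (x.2 : ℂ)))).smul
    (hasFDerivAt_snd (𝕜 := ℝ) (E := ℝ) (F := ℂ) (p := (√(g (x.1, x.2)), (x.2 : ℂ))))
  have hk := (hm.hasMFDerivAt.comp x hSz).mfderiv
  have hv : mfderiv (I.prod 𝓘(ℝ, ℂ)) 𝓘(ℝ, ℂ)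
      (fun q : F × disk => spread (fun z => g (q.1, z)) q.2) x v =
      √(g (x.1, x.2)) • v.2 + D v • (x.2 : ℂ) :=
    congrArg (fun T : E × ℂ →L[ℝ] ℂ => T v) hk
  have hs : spread (fun z => g (x.1, z)) x.2 = √(g (x.1, x.2)) • (x.2 : ℂ) := rfl
  have h1 := congrArg (areaForm (spread (fun z => g (x.1, z)) x.2)) hv
  refine h1.trans ?_
  rw [hs, areaForm_smul_add, Real.sq_sqrt ((hg.fiber x.1).pos _ x.2.2).le]

/-- A diffeomorphism over `F` which intertwines the spreading maps carries one kernel to the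
other. -/
theorem carries_of_spread_eq {α : OneForm I F} {η₀ η₁ : Distribution (I.prod 𝓘(ℝ, ℂ)) (F × disk)}
    {g₀ g₁ : F × ℂ → ℝ} (hg₀ : IsProfile I g₀) (hg₁ : IsProfile I g₁)
    (hη₀ : ∀ (x : F × disk) (v : TangentSpace (I.prod 𝓘(ℝ, ℂ)) x),
      v ∈ η₀ x ↔ α x.1 v.1 + g₀ (x.1, (x.2 : ℂ)) * areaForm (x.2 : ℂ) v.2 = 0)
    (hη₁ : ∀ (x : F × disk) (v : TangentSpace (I.prod 𝓘(ℝ, ℂ)) x),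
      v ∈ η₁ x ↔ α x.1 v.1 + g₁ (x.1, (x.2 : ℂ)) * areaForm (x.2 : ℂ) v.2 = 0)
    (ψ : (F × disk) ≃ₘ⟮I.prod 𝓘(ℝ, ℂ), I.prod 𝓘(ℝ, ℂ)⟯ (F × disk))
    (hfst : ∀ x, (ψ x).1 = x.1)
    (hψ : ∀ x, spread (fun z => g₁ (x.1, z)) (ψ x).2 = spread (fun z => g₀ (x.1, z)) x.2) :
    Carries ψ η₀ η₁ := by
  rw [carries_diffeomorph_iff]
  intro x v
  rw [hη₀, hη₁]
  have hd : MDifferentiableAt (I.prod 𝓘(ℝ, ℂ)) (I.prod 𝓘(ℝ, ℂ)) ψ x :=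
    ψ.mdifferentiable (by simp) x
  set w : E × ℂ := mfderiv (I.prod 𝓘(ℝ, ℂ)) (I.prod 𝓘(ℝ, ℂ)) ψ x v with hw
  have h1 : w.1 = v.1 := by
    have e1 := (hasMFDerivAt_fst (I := I) (I' := 𝓘(ℝ, ℂ)) (x := ψ x)).comp x hd.hasMFDerivAt
    have e2 : Prod.fst ∘ ψ = Prod.fst := funext hfst
    rw [e2] at e1
    have e3 := hasMFDerivAt_unique e1 (hasMFDerivAt_fst (I := I) (I' := 𝓘(ℝ, ℂ)) (x := x))
    exact congrArg (fun T : E × ℂ →L[ℝ] E => T v) e3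
  have h2 : g₁ ((ψ x).1, ((ψ x).2 : ℂ)) * areaForm (ψ x).2 w.2 =
      g₀ (x.1, (x.2 : ℂ)) * areaForm x.2 v.2 := by
    rw [← hg₁.areaForm_mfderiv_spread (ψ x) w, ← hg₀.areaForm_mfderiv_spread x v]
    have e1 : MDifferentiableAt (I.prod 𝓘(ℝ, ℂ)) 𝓘(ℝ, ℂ)
        (fun q : F × disk => spread (fun z => g₁ (q.1, z)) q.2) (ψ x) :=
      (hg₁.contMDiff_spread _).mdifferentiableAt (by simp)
    have e2 := (e1.hasMFDerivAt.comp x hd.hasMFDerivAt).mfderiv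
    have e3 : (fun q : F × disk => spread (fun z => g₁ (q.1, z)) q.2) ∘ ψ =
        fun q : F × disk => spread (fun z => g₀ (q.1, z)) q.2 := by
      funext q
      simp only [Function.comp_apply, hfst, hψ]
    rw [e3] at e2
    have e4 := congrArg (fun T : E × ℂ →L[ℝ] ℂ => T v) e2
    have e5 : spread (fun z => g₁ ((ψ x).1, z)) (ψ x).2 = spread (fun z => g₀ (x.1, z)) x.2 := by
      simp only [hfst, hψ]
    rw [e5]
    exact congrArg (areaForm (spread (fun z => g₀ (x.1, z)) x.2)) e4.symm
  have h3 : (α (ψ x).1 : E →L[ℝ] ℝ) w.1 = α x.1 v.1 := by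
    have : ∀ q, q = x.1 → ∀ u : E, (α q : E →L[ℝ] ℝ) u = (α x.1 : E →L[ℝ] ℝ) u := by
      rintro _ rfl u
      rfl
    rw [this _ (hfst x), h1]
  have h4 : (α (ψ x).1 : E →L[ℝ] ℝ) w.1 + g₁ ((ψ x).1, ((ψ x).2 : ℂ)) * areaForm (ψ x).2 w.2 =
      α x.1 v.1 + g₀ (x.1, (x.2 : ℂ)) * areaForm x.2 v.2 := congrArg₂ (· + ·) h3 h2
  exact (Iff.of_eq (congrArg (· = 0) h4)).symm

/-- The rotational direction `i z` has area pairing `|z|²` with `z`; a multiple of `v₀` compensates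
for it. This test vector reads the weight off the kernel. -/
theorem kernel_vector {a : E →L[ℝ] ℝ} {v₀ : E} (hv₀ : a v₀ ≠ 0) (s : ℝ) (z : ℂ) :
    a ((-(s * Complex.normSq z) / a v₀) • v₀) + s * areaForm z (Complex.I * z) = 0 := by
  rw [map_smul, smul_eq_mul, areaForm_mul_I, div_mul_cancel₀ _ hv₀]
  ring

theorem exists_apply_ne_zero {a : E →L[ℝ] ℝ} (ha : a ≠ 0) : ∃ v, a v ≠ 0 := by
  by_contra! h
  exact ha (ContinuousLinearMap.ext h)

theorem weight_eq_mul_of_kernel {a a' : E →L[ℝ] ℝ} {T : E →L[ℝ] E} {v₀ : E}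
    {z : ℂ} (hz : z ≠ 0) {s t : ℝ}
    (h : a' (T ((-(s * Complex.normSq z) / a v₀) • v₀)) + t * areaForm z (Complex.I * z) = 0) :
    t = a' (T v₀) / a v₀ * s := by
  have hn : Complex.normSq z ≠ 0 := by simpa using hz
  rw [map_smul, map_smul, smul_eq_mul, areaForm_mul_I] at h
  refine mul_right_cancel₀ hn ?_
  linear_combination h

theorem weight_eq_of_kernel_le {a : E →L[ℝ] ℝ} (ha : a ≠ 0) {z : ℂ} (hz : z ≠ 0) {s t : ℝ}
    (h : ∀ v : E × ℂ, a v.1 + s * areaForm z v.2 = 0 → a v.1 + t * areaForm z v.2 = 0) :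
    s = t := by
  obtain ⟨v₀, hv₀⟩ := exists_apply_ne_zero ha
  have h1 := weight_eq_mul_of_kernel (T := ContinuousLinearMap.id ℝ E) hz
    (h (_, Complex.I * z) (kernel_vector hv₀ s z))
  rw [ContinuousLinearMap.id_apply, div_self hv₀, one_mul] at h1
  exact h1.symm

/-- A fibered map covering a rotation of the disk which preserves `ker (α + g (x dy - y dx))`
rescales `g` by a function on the base, which depends only on the action on `α`. -/
theorem exists_rescale_of_carries {α : OneForm I F} (hα : ∀ p, α p ≠ 0) (R : F → F) (p : F) :
    ∃ u : ℝ, ∀ (ζ : Circle) (η : Distribution (I.prod 𝓘(ℝ, ℂ)) (F × disk)) (g : F × ℂ → ℝ),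
      (∀ (x : F × disk) (v : TangentSpace (I.prod 𝓘(ℝ, ℂ)) x),
        v ∈ η x ↔ α x.1 v.1 + g (x.1, (x.2 : ℂ)) * areaForm (x.2 : ℂ) v.2 = 0) →
      Carries (fun x : F × disk => (R x.1, rotDisk ζ x.2)) η η →
      ∀ z : disk, (z : ℂ) ≠ 0 → g (R p, (ζ : ℂ) * z) = u * g (p, (z : ℂ)) := by
  obtain ⟨v₀, hv₀⟩ := exists_apply_ne_zero (E := E) (hα p)
  -- The factor involves only `α`, `R` and the choice of `v₀` at `p`, so the same `u` serves for
  -- both fibrations.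
  refine ⟨α (R p) (mfderiv I I R p v₀) / α p v₀, fun ζ η g hη hc z hz => ?_⟩
  set φ : F × disk → F × disk := fun x => (R x.1, rotDisk ζ x.2) with hφ
  have hφd : MDifferentiableAt (I.prod 𝓘(ℝ, ℂ)) (I.prod 𝓘(ℝ, ℂ)) φ (p, z) := by
    -- Otherwise `mfderiv` takes its default value zero, and `Carries` would make `η` trivial at the
    -- image point, although it contains a vector with nonzero disk component.
    by_contra hnd
    obtain ⟨w₀, hw₀⟩ := exists_apply_ne_zero (E := E) (hα (R p))
    have h1 := hc (p, z)
    have hmem : (((-(g (R p, (ζ : ℂ) * z) * Complex.normSq ((ζ : ℂ) * z)) / α (R p) w₀) • w₀,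
        Complex.I * ((ζ : ℂ) * z)) : E × ℂ) ∈ η (φ (p, z)) :=
      (hη (φ (p, z)) _).2 (kernel_vector hw₀ _ _)
    rw [← h1] at hmem
    obtain ⟨v, -, hv⟩ := hmem
    have h2 : (mfderiv (I.prod 𝓘(ℝ, ℂ)) (I.prod 𝓘(ℝ, ℂ)) φ (p, z) v : E × ℂ) = 0 := by
      rw [mfderiv_zero_of_not_mdifferentiableAt hnd]
      rfl
    have h3 : Complex.I * ((ζ : ℂ) * z) = 0 :=
      congrArg Prod.snd (hv.symm.trans h2)
    exact mul_ne_zero Complex.I_ne_zero (mul_ne_zero (Circle.coe_ne_zero ζ) hz) h3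
  set v : E × ℂ := ((-(g (p, (z : ℂ)) * Complex.normSq (z : ℂ)) / α p v₀) • v₀,
    Complex.I * z) with hv
  have hvη : v ∈ η (p, z) := (hη (p, z) v).2 (kernel_vector hv₀ _ _)
  have hDv : mfderiv (I.prod 𝓘(ℝ, ℂ)) (I.prod 𝓘(ℝ, ℂ)) φ (p, z) v ∈ η (φ (p, z)) := by
    rw [← hc (p, z)]
    exact ⟨v, hvη, rfl⟩
  set w : E × ℂ := mfderiv (I.prod 𝓘(ℝ, ℂ)) (I.prod 𝓘(ℝ, ℂ)) φ (p, z) v with hw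
  have hRd : MDifferentiableAt I I R p := by
    have e1 : MDifferentiableAt I (I.prod 𝓘(ℝ, ℂ)) (fun q : F => (q, z)) p :=
      mdifferentiableAt_id.prodMk mdifferentiableAt_const
    have e2 : MDifferentiableAt (I.prod 𝓘(ℝ, ℂ)) I Prod.fst (φ (p, z)) := mdifferentiableAt_fst
    exact MDifferentiableAt.comp (f := fun q : F => (q, z)) p (e2.comp (p, z) hφd) e1
  have hw1 : w.1 = mfderiv I I R p v.1 := by
    have e1 := (hasMFDerivAt_fst (I := I) (I' := 𝓘(ℝ, ℂ)) (x := φ (p, z))).comp (p, z)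
      hφd.hasMFDerivAt
    have e2 := hRd.hasMFDerivAt.comp (p, z)
      (hasMFDerivAt_fst (I := I) (I' := 𝓘(ℝ, ℂ)) (x := (p, z)))
    have e3 : Prod.fst ∘ φ = R ∘ Prod.fst := rfl
    rw [e3] at e1
    exact congrArg (fun T : E × ℂ →L[ℝ] E => T v) (hasMFDerivAt_unique e1 e2)
  have hw2 : w.2 = (ζ : ℂ) * v.2 := by
    have e1 := ((hasMFDerivAt_disk_coe (φ (p, z)).2).comp (φ (p, z))
      (hasMFDerivAt_snd (I := I) (I' := 𝓘(ℝ, ℂ)) (x := φ (p, z)))).comp (p, z) hφd.hasMFDerivAt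
    have e0 : HasFDerivAt (fun w : ℂ => (ζ : ℂ) * w)
        (ContinuousLinearMap.mul ℝ ℂ (ζ : ℂ)) (z : ℂ) :=
      (ContinuousLinearMap.mul ℝ ℂ (ζ : ℂ)).hasFDerivAt
    have e2 := e0.hasMFDerivAt.comp (p, z) ((hasMFDerivAt_disk_coe z).comp (p, z)
      (hasMFDerivAt_snd (I := I) (I' := 𝓘(ℝ, ℂ)) (x := (p, z))))
    exact congrArg (fun T : E × ℂ →L[ℝ] ℂ => T v) (hasMFDerivAt_unique e1 e2)
  have hfin : (α (R p) : E →L[ℝ] ℝ) w.1 + g (R p, (ζ : ℂ) * z) * areaForm ((ζ : ℂ) * z) w.2 = 0 :=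
    (hη (φ (p, z)) w).1 hDv
  rw [hw1, hw2, areaForm_circle_mul] at hfin
  exact weight_eq_mul_of_kernel (E := E) (T := mfderiv I I R p) hz hfin

end Model

/-! ### The relative and equivariant isotopy on the model. -/

section Isotopy

theorem spread_rescale {a b : ℂ → ℝ} {z : ℂ} {u : ℝ} {ζ : Circle} (hu : 0 ≤ u)
    (h : b ((ζ : ℂ) * z) = u * a z) :
    spread b ((ζ : ℂ) * z) = (√u * (ζ : ℂ)) * spread a z := by
  simp only [spread, h, Real.sqrt_mul hu, Complex.real_smul]
  push_cast
  ring

theorem IsDiskProfile.spread_ne_zero {a : ℂ → ℝ} (ha : IsDiskProfile a) {z : ℂ}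
    (hz : z ∈ Metric.ball (0 : ℂ) 1) (hz0 : z ≠ 0) : spread a z ≠ 0 :=
  smul_ne_zero (Real.sqrt_pos.2 (ha.pos z hz)).ne' hz0

variable {E : Type} [NormedAddCommGroup E] [NormedSpace ℝ E] [FiniteDimensional ℝ E]
  {H : Type*} [TopologicalSpace H] {I : ModelWithCorners ℝ E H} [I.Boundaryless]
  {F : Type*} [TopologicalSpace F] [ChartedSpace H F] [IsManifold I ∞ F]

/-- Two radial contact fibrations with the same contact fiber which agree near the boundary are
isotopic relative to the boundary, by an isotopy which commutes with all the symmetries common to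
both of them which cover rotations of the disk. -/
theorem exists_model_isotopy {α : OneForm I F} (hα : α.IsContactOn univ)
    {η₀ η₁ : Distribution (I.prod 𝓘(ℝ, ℂ)) (F × disk)}
    (hη₀ : IsRadialContactFibration α η₀) (hη₁ : IsRadialContactFibration α η₁)
    (hnear : ∀ᶠ x in nearBoundary F, η₀ x = η₁ x) :
    ∃ Ψ : ℝ → (F × disk) ≃ₘ⟮I.prod 𝓘(ℝ, ℂ), I.prod 𝓘(ℝ, ℂ)⟯ (F × disk),
      ContMDiff (𝓘(ℝ, ℝ).prod (I.prod 𝓘(ℝ, ℂ))) (I.prod 𝓘(ℝ, ℂ)) ∞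
        (fun q : ℝ × (F × disk) => Ψ q.1 q.2) ∧
      (∀ x, Ψ 0 x = x) ∧ Carries (Ψ 1) η₀ η₁ ∧
      (∀ᶠ x in nearBoundary F, ∀ t, Ψ t x = x) ∧
      ∀ (R : F → F) (ζ : Circle),
        Carries (fun x : F × disk => (R x.1, rotDisk ζ x.2)) η₀ η₀ →
        Carries (fun x : F × disk => (R x.1, rotDisk ζ x.2)) η₁ η₁ →
        ∀ (t : ℝ) (x : F × disk),
          Ψ t (R x.1, rotDisk ζ x.2) = (R (Ψ t x).1, rotDisk ζ (Ψ t x).2) := by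
  have hα0 : ∀ p, α p ≠ 0 := fun p => hα.ne_zero p (mem_univ p)
  obtain ⟨g₀, hg₀, hk₀⟩ := hη₀.exists_profile hα
  obtain ⟨g₁, hg₁, hk₁⟩ := hη₁.exists_profile hα
  have hg : ∀ᶠ x in nearBoundary F, g₀ (x.1, (x.2 : ℂ)) = g₁ (x.1, (x.2 : ℂ)) := by
    filter_upwards [hnear, eventually_nearBoundary_ne_zero] with x hx hx0
    refine weight_eq_of_kernel_le (E := E) (hα0 x.1) hx0 fun v hv => ?_
    have h1 := (hk₀ x v).2 hv
    rw [hx] at h1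
    exact (hk₁ x v).1 h1
  obtain ⟨Ψ, hΨs, hΨ⟩ := hg₀.exists_isotopy hg₁
    fun p e he => eventually_slice_of_nearBoundary (p := fun y => g₀ y = g₁ y) hg p he
  have hI := hg₀.interpolate hg₁
  -- Where the interpolated weight equals `g₀`, the point `x` itself solves the equation defining `Ψ
  -- t x`. This covers both time zero and the region near the boundary.
  have hfix : ∀ t x, interpolation g₀ g₁ ((t, x.1), (x.2 : ℂ)) = g₀ (x.1, (x.2 : ℂ)) →
      Ψ t x = x := by
    intro t x hx
    refine Prod.ext (hΨ t x).1 (Subtype.ext ?_)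
    refine (hI.fiber (t, x.1)).injOn_spread (Ψ t x).2.2 x.2.2 ((hΨ t x).2.trans ?_)
    simp only [spread, hx]
  refine ⟨Ψ, hΨs, fun x => hfix 0 x (by simp [interpolation]), ?_, ?_, ?_⟩
  · refine carries_of_spread_eq hg₀ hg₁ hk₀ hk₁ (Ψ 1) (fun x => (hΨ 1 x).1) fun x => ?_
    rw [← (hΨ 1 x).2]
    simp [interpolation]
  · filter_upwards [hg] with x hx t
    refine hfix t x ?_
    simp only [interpolation, hx]
    ring
  · intro R ζ hc₀ hc₁ t x
    obtain ⟨u, hu⟩ := exists_rescale_of_carries hα0 R x.1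
    have hu₀ := hu ζ η₀ g₀ hk₀ hc₀
    have hu₁ := hu ζ η₁ g₁ hk₁ hc₁
    set y : F × disk := (R x.1, rotDisk ζ x.2) with hy
    have hrot : ∀ z : disk, ((rotDisk ζ z : disk) : ℂ) = (ζ : ℂ) * z := fun z => rfl
    have hΨx := hΨ t x
    refine Prod.ext ((hΨ t y).1.trans ?_) (Subtype.ext ?_)
    · rw [hΨx.1]
    -- Both candidates lie over `R x.1`, so it suffices to compare their images under the spreading
    -- map of the interpolated profile.
    refine (hI.fiber (t, R x.1)).injOn_spread (Ψ t y).2.2 (rotDisk ζ (Ψ t x).2).2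
      ((hΨ t y).2.trans ?_)
    change spread (fun z => g₀ (R x.1, z)) ((ζ : ℂ) * x.2) =
      spread (fun z => interpolation g₀ g₁ ((t, R x.1), z)) ((ζ : ℂ) * (Ψ t x).2)
    -- The rescaling relation is available only off the origin of the disk; over the origin both
    -- sides vanish.
    by_cases hz : (x.2 : ℂ) = 0
    · have hw : ((Ψ t x).2 : ℂ) = 0 := by
        by_contra h0
        refine (hI.fiber (t, x.1)).spread_ne_zero (Ψ t x).2.2 h0 (hΨx.2.trans ?_)
        simp [spread, hz]
      simp [spread, hz, hw]
    · have hw : ((Ψ t x).2 : ℂ) ≠ 0 := by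
        intro h0
        refine (hg₀.fiber x.1).spread_ne_zero x.2.2 hz (hΨx.2.symm.trans ?_)
        simp [spread, h0]
      -- `u` is a ratio of two values of the positive function `g₀`, so its square root can be
      -- pulled out of the spreading map.
      have hupos : 0 ≤ u := by
        have h1 := hu₀ x.2 hz
        have h2 := (hg₀.fiber (R x.1)).pos _ (rotDisk ζ x.2).2
        rw [hrot, h1] at h2
        exact (pos_of_mul_pos_left h2 ((hg₀.fiber x.1).pos _ x.2.2).le).le
      rw [spread_rescale (a := fun z => g₀ (x.1, z)) hupos (hu₀ x.2 hz),
        spread_rescale (a := fun z => interpolation g₀ g₁ ((t, x.1), z)) hupos, hΨx.2]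
      simp only [interpolation, hu₀ _ hw, hu₁ _ hw]
      ring

theorem mfderiv_diffeomorph_injective {E₁ : Type*} [NormedAddCommGroup E₁] [NormedSpace ℝ E₁]
    {H₁ : Type*} [TopologicalSpace H₁] {J : ModelWithCorners ℝ E₁ H₁}
    {E₂ : Type*} [NormedAddCommGroup E₂] [NormedSpace ℝ E₂]
    {H₂ : Type*} [TopologicalSpace H₂] {J' : ModelWithCorners ℝ E₂ H₂}
    {M : Type*} [TopologicalSpace M] [ChartedSpace H₁ M]
    {N : Type*} [TopologicalSpace N] [ChartedSpace H₂ N]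
    (φ : M ≃ₘ⟮J, J'⟯ N) (x : M) (v : TangentSpace J x) (hv : mfderiv J J' φ x v = 0) : v = 0 := by
  have h1 := mfderiv_diffeomorph_symm_apply φ x v
  exact h1.symm.trans ((congrArg (mfderiv J' J φ.symm (φ x)) hv).trans (map_zero _))

end Isotopy

end RadialContact

end

/-! ### Transport of the model isotopy to `V`. -/

theorem lemma6p3 {d : ℕ}
    -- the manifold `V`
    {V : Type*} [TopologicalSpace V] [ChartedSpace (EuclideanSpace ℝ (Fin (d + 2))) V]
    [IsManifold (𝓡 (d + 2)) ∞ V]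
    -- the fiber `F` with its contact form `α`
    {F : Type*} [TopologicalSpace F] [ChartedSpace (EuclideanSpace ℝ (Fin d)) F]
    [IsManifold (𝓡 d) ∞ F]
    (α : RadialContact.OneForm (𝓡 d) F) (hα : α.IsContactOn univ)
    -- two contact structures on `V`
    (ξ₀ ξ₁ : RadialContact.Distribution (𝓡 (d + 2)) V)
    (hξ₀ : RadialContact.IsContactStructure ξ₀) (hξ₁ : RadialContact.IsContactStructure ξ₁)
    -- two radial contact fibrations on `F × B²`
    (η₀ η₁ : RadialContact.Distribution ((𝓡 d).prod 𝓘(ℝ, ℂ)) (F × RadialContact.disk))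
    (hη₀ : RadialContact.IsRadialContactFibration α η₀)
    (hη₁ : RadialContact.IsRadialContactFibration α η₁)
    -- a smooth isotopy `f` of diffeomorphisms `V → F × B²`, with endpoints `f 0` and `f 1`
    (f : ℝ → V ≃ₘ⟮𝓡 (d + 2), (𝓡 d).prod 𝓘(ℝ, ℂ)⟯ (F × RadialContact.disk))
    (hf : RadialContact.IsSmoothIsotopy f)
    (hf₀ : RadialContact.Carries (f 0) ξ₀ η₀) (hf₁ : RadialContact.Carries (f 1) ξ₁ η₁)
    -- the identifications and the contact structures agree near the boundary
    (hid : ∀ᶠ x in RadialContact.nearBoundary F, f 1 ((f 0).symm x) = x)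
    (hagree : ∀ᶠ x in RadialContact.nearBoundary F, ξ₀ ((f 0).symm x) = ξ₁ ((f 0).symm x)) :
    -- the contact structures are isotopic, relative to the boundary if `f` is so
    (∃ Φ : ℝ → V ≃ₘ⟮𝓡 (d + 2), 𝓡 (d + 2)⟯ V,
      RadialContact.IsIsotopyBetween Φ ξ₀ ξ₁ ∧
      (∀ᶠ x in RadialContact.nearBoundary F, Φ 1 ((f 0).symm x) = (f 0).symm x) ∧
      ((∀ᶠ x in RadialContact.nearBoundary F, ∀ t ∈ Icc (0 : ℝ) 1, f t ((f 0).symm x) = x) →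
        ∀ᶠ x in RadialContact.nearBoundary F, ∀ t ∈ Icc (0 : ℝ) 1,
          Φ t ((f 0).symm x) = (f 0).symm x)) ∧
    -- the equivariant case, with fiber diffeomorphic to an odd sphere
    (∀ (n a : ℕ) [NeZero a] (σ : F ≃ₘ⟮𝓡 d, 𝓡 (2 * n + 1)⟯ (RadialContact.oddSphere n)),
      (∀ k : ZMod a, RadialContact.Carries
        (RadialContact.diagonalAction σ.toEquiv k) η₀ η₀) →
      (∀ k : ZMod a, RadialContact.Carries
        (RadialContact.diagonalAction σ.toEquiv k) η₁ η₁) →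
      -- on the model: an equivariant isotopy relative to the boundary
      (∃ Ψ : ℝ → (F × RadialContact.disk) ≃ₘ⟮(𝓡 d).prod 𝓘(ℝ, ℂ), (𝓡 d).prod 𝓘(ℝ, ℂ)⟯
            (F × RadialContact.disk),
        RadialContact.IsIsotopyBetween Ψ η₀ η₁ ∧
        (∀ᶠ x in RadialContact.nearBoundary F, ∀ t ∈ Icc (0 : ℝ) 1, Ψ t x = x) ∧
        ∀ t ∈ Icc (0 : ℝ) 1, ∀ (k : ZMod a) (x : F × RadialContact.disk),
          Ψ t (RadialContact.diagonalAction σ.toEquiv k x) =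
            RadialContact.diagonalAction σ.toEquiv k (Ψ t x)) ∧
      -- on `V`: an equivariant isotopy, for every action for which `f` is equivariant
      (∀ [AddAction (ZMod a) V],
        (∀ t ∈ Icc (0 : ℝ) 1, ∀ (k : ZMod a) (v : V),
          f t (k +ᵥ v) = RadialContact.diagonalAction σ.toEquiv k (f t v)) →
        ∃ Φ : ℝ → V ≃ₘ⟮𝓡 (d + 2), 𝓡 (d + 2)⟯ V,
          RadialContact.IsIsotopyBetween Φ ξ₀ ξ₁ ∧
          (∀ᶠ x in RadialContact.nearBoundary F, Φ 1 ((f 0).symm x) = (f 0).symm x) ∧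
          ((∀ᶠ x in RadialContact.nearBoundary F, ∀ t ∈ Icc (0 : ℝ) 1, f t ((f 0).symm x) = x) →
            ∀ᶠ x in RadialContact.nearBoundary F, ∀ t ∈ Icc (0 : ℝ) 1,
              Φ t ((f 0).symm x) = (f 0).symm x) ∧
          ∀ t ∈ Icc (0 : ℝ) 1, ∀ (k : ZMod a) (v : V), Φ t (k +ᵥ v) = k +ᵥ Φ t v)) := by
  have hχ : ∀ t, Real.smoothTransition t ∈ Icc (0 : ℝ) 1 := fun t =>
    ⟨Real.smoothTransition.nonneg t, Real.smoothTransition.le_one t⟩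
  -- Near the boundary `f 0` and `f 1` have the same germs and transport the same planes, so the two
  -- fibrations agree there.
  have hnear : ∀ᶠ x in RadialContact.nearBoundary F, η₀ x = η₁ x := by
    filter_upwards [RadialContact.eventually_eventually_nearBoundary hid, hagree] with x hx hξ
    have h1 : f 1 =ᶠ[𝓝 ((f 0).symm x)] f 0 := by
      have h2 : Tendsto (f 0) (𝓝 ((f 0).symm x)) (𝓝 x) := by
        have := (f 0).continuous.tendsto ((f 0).symm x)
        rwa [(f 0).apply_symm_apply] at this
      filter_upwards [h2.eventually hx] with y hy
      rwa [(f 0).symm_apply_apply] at hy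
    have h3 := RadialContact.Carries.eq_of_eventuallyEq hf₀ hf₁ hξ h1
    rwa [(f 0).apply_symm_apply] at h3
  obtain ⟨Ψ, hΨs, hΨ0, hΨ1, hΨb, hΨe⟩ :=
    RadialContact.exists_model_isotopy hα hη₀ hη₁ hnear
  -- `f` is controlled only for times in `[0, 1]`. The transition function keeps its time there for
  -- every real `t`, fixes the endpoints, and makes the family smooth on all of `ℝ × V`.
  let Φ : ℝ → V ≃ₘ⟮𝓡 (d + 2), 𝓡 (d + 2)⟯ V := fun t =>
    ((f 0).trans (Ψ t)).trans (f (Real.smoothTransition t)).symm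
  have hΦ : ∀ t v, f (Real.smoothTransition t) (Φ t v) = Ψ t (f 0 v) := fun t v =>
    (f (Real.smoothTransition t)).apply_symm_apply _
  have hcancel : ∀ {t v w}, Ψ t (f 0 v) = f (Real.smoothTransition t) w → Φ t v = w :=
    fun {t v _} h => (f (Real.smoothTransition t)).injective ((hΦ t v).trans h)
  have hΦs : RadialContact.IsSmoothIsotopy Φ := by
    refine ContMDiff.contMDiffOn ?_
    refine RadialContact.contMDiff_of_family_comp_eq (I₁ := 𝓘(ℝ, ℝ)) (P := ℝ)
      (I' := (𝓡 d).prod 𝓘(ℝ, ℂ)) (N := F × RadialContact.disk)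
      (k := fun q : ℝ × V => f (Real.smoothTransition q.1) q.2)
      (L := fun q : ℝ × V => Ψ q.1 (f 0 q.2)) (b := Prod.fst) ?_ ?_ ?_ ?_ ?_ contMDiff_fst ?_
    · simp [Complex.finrank_real_complex]
    · rw [← contMDiffOn_univ]
      refine ContMDiffOn.comp hf (f := fun q : ℝ × V => (Real.smoothTransition q.1, q.2))
        (ContMDiff.contMDiffOn ?_) fun q _ => ⟨hχ q.1, mem_univ _⟩
      exact ((Real.smoothTransition.contDiff (n := ⊤)).contMDiff.comp contMDiff_fst).prodMk
        contMDiff_snd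
    · exact fun t => (f (Real.smoothTransition t)).injective
    · exact fun t => RadialContact.mfderiv_diffeomorph_injective (f (Real.smoothTransition t))
    · exact hΨs.comp (contMDiff_fst.prodMk ((f 0).contMDiff.comp contMDiff_snd))
    · exact fun q => hΦ q.1 q.2
  have hΦ0 : ∀ v, Φ 0 v = v := by
    intro v
    refine hcancel ?_
    rw [Real.smoothTransition.zero, hΨ0]
  have hΦ1 : RadialContact.Carries (Φ 1) ξ₀ ξ₁ := by
    have h1 : ∀ s, s = 1 →
        RadialContact.Carries (((f 0).trans (Ψ 1)).trans (f s).symm) ξ₀ ξ₁ := by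
      rintro _ rfl
      exact (hf₀.trans hΨ1).trans hf₁.symm
    exact h1 _ Real.smoothTransition.one
  have hΦbd : ∀ᶠ x in RadialContact.nearBoundary F, Φ 1 ((f 0).symm x) = (f 0).symm x := by
    filter_upwards [hid, hΨb] with x hx hΨx
    refine hcancel ?_
    rw [Real.smoothTransition.one, (f 0).apply_symm_apply, hΨx, hx]
  have hΦrel : (∀ᶠ x in RadialContact.nearBoundary F, ∀ t ∈ Icc (0 : ℝ) 1,
      f t ((f 0).symm x) = x) → ∀ᶠ x in RadialContact.nearBoundary F, ∀ t ∈ Icc (0 : ℝ) 1,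
      Φ t ((f 0).symm x) = (f 0).symm x := by
    intro h
    filter_upwards [h, hΨb] with x hx hΨx t _
    refine hcancel ?_
    rw [(f 0).apply_symm_apply, hΨx, hx _ (hχ t)]
  refine ⟨⟨Φ, ⟨hΦs, hΦ0, hΦ1⟩, hΦbd, hΦrel⟩, fun n a _ σ hσ₀ hσ₁ => ?_⟩
  have hΨeq : ∀ (t : ℝ) (k : ZMod a) (x : F × RadialContact.disk),
      Ψ t (RadialContact.diagonalAction σ.toEquiv k x) =
        RadialContact.diagonalAction σ.toEquiv k (Ψ t x) := fun t k x =>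
    -- The diagonal action covers a rotation of the disk; its fiber part, conjugated by `σ`, plays
    -- the role of `R`.
    hΨe (fun p => σ.toEquiv.symm (RadialContact.rotSphere (ZMod.toCircle k) (σ.toEquiv p)))
      (ZMod.toCircle k) (hσ₀ k) (hσ₁ k) t x
  refine ⟨⟨Ψ, ⟨hΨs.contMDiffOn, hΨ0, hΨ1⟩, hΨb.mono fun x hx t _ => hx t,
    fun t _ => hΨeq t⟩, fun hf_eq => ⟨Φ, ⟨hΦs, hΦ0, hΦ1⟩, hΦbd, hΦrel, fun t _ k v => ?_⟩⟩
  -- Equivariance of `f` at the smoothed time, at time `0`, and of `Ψ` gives both sides the same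
  -- image under the injective map `f (Real.smoothTransition t)`.
  refine hcancel ?_
  rw [hf_eq _ (hχ t), hΦ, hf_eq 0 (left_mem_Icc.2 zero_le_one), hΨeq]
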